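/- Let $d\ge 1$ and let $\mathbb R^{d+1}_+=\mathbb R^d\times(0,\infty)$. For $1<p<\infty$ let $H^p(\mathbb R^{d+1}_+)$ be the space of (complex-valued) harmonic functions $u$ on $\mathbb R^{d+1}_+$ with $\|u\|_{H^p}:=\sup_{t>0}\|u(\cdot,t)\|_{L^p(\mathbb R^d)}<\infty$. For $\alpha>0$, a non-negative Borel measure $\mu$ on $\mathbb R^{d+1}_+$ is called an embedding $\alpha$-Carleson measure if, for some $r\in[1,\infty)$ with $\alpha r>1$, there is a constant $M$ such that $\|u\|_{L^r(\mathbb R^{d+1}_+,\mu)}\le M\,\|u\|_{H^{\alpha r}(\mathbb R^{d+1}_+)}$ for all $u\in H^{\alpha r}(\mathbb R^{d+1}_+)$. Theorem. Let $q\in(1,\infty)$ and $\alpha>1/q$. Let $\Phi$ be a measurable complex-valued function on $\mathbb R^d$ for which there is a radial, radially non-increasing, bounded and integrable function $\varphi$ on $\mathbb R^d$ with $|\Phi(x)|\le\varphi(x)$ for almost every $x$, and put $\Phi_t(x):=t^{-d}\Phi(x/t)$ for $t>0$. Then for every embedding $\alpha$-Carleson measure $\mu$ on $\mathbb R^{d+1}_+$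 there is a constant $c$ such that for all $f\in L^{\alpha q}(\mathbb R^d)$ the convolution $(\Phi_t*f)(x)$ exists for every $(x,t)\in\mathbb R^{d+1}_+$, is a $\mu$-measurable function of $(x,t)$, and satisfies $$\Bigl(\int_{\mathbb R^{d+1}_+}\bigl|(\Phi_t*f)(x)\bigr|^q\,d\mu(x,t)\Bigr)^{1/q}\le c\,\|f\|_{L^{\alpha q}(\mathbb R^d)}.$$ -/

import Mathlib

open MeasureTheory
open scoped ENNReal NNReal

namespace CarlesonMeasure

/-- The upper half space `ℝ^d × (0, ∞)`. A (non-negative) Borel measure on it is a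
`Measure (UpperHalf d)`. -/
abbrev UpperHalf (d : ℕ) : Type := EuclideanSpace ℝ (Fin d) × Set.Ioi (0 : ℝ)

/-- `u` is harmonic on `ℝ^d × (0, ∞)`: it is of class `C²` there and
`Δ_x u + ∂_t² u = 0`. Values `u x t` with `t ≤ 0` are irrelevant. -/
def IsHarmonicOnUpperHalf {d : ℕ} (u : EuclideanSpace ℝ (Fin d) → ℝ → ℂ) : Prop :=
  ContDiffOn ℝ 2 (fun z : EuclideanSpace ℝ (Fin d) × ℝ => u z.1 z.2) {z | 0 < z.2} ∧
    ∀ x : EuclideanSpace ℝ (Fin d), ∀ t : ℝ, 0 < t →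
      Laplacian.laplacian (fun y => u y t) x + iteratedDeriv 2 (fun s => u x s) t = 0

/-- The Hardy norm `sup_{t > 0} ‖u(·, t)‖_{L^p(ℝ^d)}`. -/
noncomputable def hardyNorm {d : ℕ} (p : ℝ≥0∞) (u : EuclideanSpace ℝ (Fin d) → ℝ → ℂ) :
    ℝ≥0∞ :=
  ⨆ t : Set.Ioi (0 : ℝ), eLpNorm (fun x => u x t) p volume

/-- Membership in the Hardy space `H^p(ℝ^d × (0, ∞))` of harmonic functions. -/
def MemHardy {d : ℕ} (p : ℝ≥0∞) (u : EuclideanSpace ℝ (Fin d) → ℝ → ℂ) : Prop :=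
  IsHarmonicOnUpperHalf u ∧ hardyNorm p u < ∞

/-- The embedding estimate `‖u‖_{L^q(μ)} ≤ M ‖u‖_{H^{αq}}` for all `u ∈ H^{αq}`, at a given
exponent `q`. -/
def EmbeddingEstimate {d : ℕ} (α q : ℝ) (μ : Measure (UpperHalf d)) : Prop :=
  ∃ M : ℝ≥0, ∀ u : EuclideanSpace ℝ (Fin d) → ℝ → ℂ,
    MemHardy (ENNReal.ofReal (α * q)) u →
      eLpNorm (fun z : UpperHalf d => u z.1 z.2) (ENNReal.ofReal q) μ
        ≤ M * hardyNorm (ENNReal.ofReal (α * q)) u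

/-- `μ` is an embedding `α`-Carleson measure: the embedding estimate holds at some admissible
exponent, that is, at some `q ∈ [1, ∞)` with `α q > 1`. -/
def IsEmbeddingCarleson {d : ℕ} (α : ℝ) (μ : Measure (UpperHalf d)) : Prop :=
  0 < α ∧ ∃ q : ℝ, 1 ≤ q ∧ 1 < α * q ∧ EmbeddingEstimate α q μ

/-- `Φ` is dominated by a radial, non-increasing, bounded and integrable function. -/
def HasRadialMajorant {d : ℕ} (Φ : EuclideanSpace ℝ (Fin d) → ℂ) : Prop :=
  ∃ φ : EuclideanSpace ℝ (Fin d) → ℝ,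
    (∀ x y, ‖x‖ = ‖y‖ → φ x = φ y) ∧
    (∀ x y, ‖x‖ ≤ ‖y‖ → φ y ≤ φ x) ∧
    (∃ B : ℝ, ∀ x, |φ x| ≤ B) ∧
    Integrable φ volume ∧
    ∀ᵐ x ∂volume, ‖Φ x‖ ≤ φ x

/-- The dilation `Φ_t(x) = t^{-d} Φ(x / t)`. -/
noncomputable def dilate {d : ℕ} (Φ : EuclideanSpace ℝ (Fin d) → ℂ) (t : ℝ) :
    EuclideanSpace ℝ (Fin d) → ℂ :=
  fun x => ((t ^ d)⁻¹ : ℝ) • Φ (t⁻¹ • x)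

/-- The function `(x, t) ↦ (Φ_t ∗ f)(x)` on the upper half space. -/
noncomputable def dilateConv {d : ℕ} (Φ f : EuclideanSpace ℝ (Fin d) → ℂ) :
    UpperHalf d → ℂ :=
  fun z => convolution (dilate Φ z.2) f (ContinuousLinearMap.mul ℝ ℂ) volume z.1

end CarlesonMeasure

/-! The estimate is reduced to the single exponent `r` at which the embedding is assumed; no
geometric description of Carleson measures is used. Write `M f` for the Hardy–Littlewood maximal
function.

Since `Φ` has a radially non-increasing integrable majorant, `|Φ_t ∗ f (x)| ≤ C · M f (x')` for
every `x'` with `|x - x'| ≤ t`, not only for `x' = x` (`exists_lintegral_enorm_dilate_mul_le`). Put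
`h = (C · M f)^(q/r)`. Then `|Φ_t ∗ f (x)|^(q/r)` is a lower bound of `h` on the ball `B(x, t)`. The
Poisson kernel is at least a constant times `t^(-d)` there, so `|Φ_t ∗ f (x)|^(q/r) ≤ e · P[h](x,
t)` (`exists_le_poissonLIntegral`).

Raising to the power `r` and integrating against `μ`, the embedding bounds `∫ P[h]^r dμ` by `(∫ h^(α
r))^(1/α)` up to a constant (`exists_lintegral_poissonLIntegral_rpow_le`). As `h^(α r) = (C · M
f)^(α q)` and `α q > 1`, the maximal theorem (`exists_lintegral_maximalFunction_rpow_le`) finishes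
the proof. -/

namespace HardyLittlewood

/-! ### The Hardy–Littlewood maximal theorem. -/

open Metric Module Set

set_option linter.unusedSectionVars false

variable {E : Type*} [NormedAddCommGroup E] [NormedSpace ℝ E] [FiniteDimensional ℝ E]
  [MeasurableSpace E] [BorelSpace E]

/-- The centred Hardy–Littlewood maximal function, with the supremum taken over closed balls of
rational radius. -/
noncomputable def maximalFunction (m : Measure E) (g : E → ℝ≥0∞) (x : E) : ℝ≥0∞ :=
  ⨆ r : {r : ℚ // 0 < r},
    (m (closedBall x (r.1 : ℝ)))⁻¹ * ∫⁻ y in closedBall x (r.1 : ℝ), g y ∂m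

variable (m : Measure E) [m.IsAddHaarMeasure]

theorem measure_closedBall_eq (x : E) {r : ℝ} (hr : 0 ≤ r) :
    m (closedBall x r) = ENNReal.ofReal (r ^ finrank ℝ E) * m (closedBall 0 1) :=
  Measure.addHaar_closedBall' m x hr

theorem measure_closedBall_ne_zero (x : E) {r : ℝ} (hr : 0 < r) : m (closedBall x r) ≠ 0 :=
  (measure_closedBall_pos m x hr).ne'

theorem measure_closedBall_ne_top (x : E) (r : ℝ) : m (closedBall x r) ≠ ∞ :=
  measure_closedBall_lt_top.ne

theorem measurable_setLIntegral_closedBall {g : E → ℝ≥0∞} (hg : Measurable g) (r : ℝ) :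
    Measurable fun x => ∫⁻ y in closedBall x r, g y ∂m := by
  have h : Measurable (fun z : E × E => {z : E × E | dist z.2 z.1 ≤ r}.indicator
      (fun z => g z.2) z) :=
    (hg.comp measurable_snd).indicator
      (measurableSet_le (measurable_snd.dist measurable_fst) measurable_const)
  convert h.lintegral_prod_right' (ν := m) using 2 with x
  rw [← lintegral_indicator measurableSet_closedBall]
  rfl

/-- Rational radii make the supremum countable, and the volume of a ball does not depend on its
centre. -/
theorem measurable_maximalFunction {g : E → ℝ≥0∞} (hg : Measurable g) :
    Measurable (maximalFunction m g) := by
  refine Measurable.iSup fun r => ?_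
  have h0 : (0 : ℝ) ≤ r.1 := by exact_mod_cast r.2.le
  simp_rw [measure_closedBall_eq m _ h0]
  exact (measurable_setLIntegral_closedBall m hg _).const_mul _

/-- A real radius is enlarged to a rational one below `2 * r`, which costs the factor `2 ^ n`. -/
theorem setLIntegral_closedBall_le_mul_maximalFunction (g : E → ℝ≥0∞) (x : E) {r : ℝ}
    (hr : 0 < r) :
    ∫⁻ y in closedBall x r, g y ∂m ≤
      ENNReal.ofReal (2 ^ finrank ℝ E) * m (closedBall x r) * maximalFunction m g x := by
  obtain ⟨s, hs, hs'⟩ := exists_rat_btwn (show r < 2 * r by linarith)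
  have hs0 : (0 : ℝ) < s := hr.trans hs
  calc ∫⁻ y in closedBall x r, g y ∂m ≤ ∫⁻ y in closedBall x (s : ℝ), g y ∂m :=
        lintegral_mono_set (closedBall_subset_closedBall hs.le)
    _ = m (closedBall x s) * ((m (closedBall x s))⁻¹ * ∫⁻ y in closedBall x (s : ℝ), g y ∂m) := by
        rw [← mul_assoc, ENNReal.mul_inv_cancel (measure_closedBall_ne_zero m x hs0)
          (measure_closedBall_ne_top m x _), one_mul]
    _ ≤ m (closedBall x s) * maximalFunction m g x := by
        gcongr
        exact le_iSup (fun r : {r : ℚ // 0 < r} =>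
          (m (closedBall x (r.1 : ℝ)))⁻¹ * ∫⁻ y in closedBall x (r.1 : ℝ), g y ∂m)
          ⟨s, by exact_mod_cast hs0⟩
    _ ≤ _ := by
        gcongr
        rw [measure_closedBall_eq m x hs0.le, measure_closedBall_eq m x hr.le, ← mul_assoc,
          ← ENNReal.ofReal_mul (by positivity), ← mul_pow]
        gcongr

/-- The weak type `(1,1)` inequality for the maximal function. -/
theorem measure_lt_maximalFunction_le [Nontrivial E] (g : E → ℝ≥0∞) {c : ℝ≥0∞} (hc : c ≠ 0)
    (hc' : c ≠ ∞) :
    m {x | c < maximalFunction m g x} ≤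
      ENNReal.ofReal (5 ^ finrank ℝ E) * (c⁻¹ * ∫⁻ y, g y ∂m) := by
  by_cases hI : ∫⁻ y, g y ∂m = ∞
  · rw [hI, ENNReal.mul_top (ENNReal.inv_ne_zero.2 hc'), ENNReal.mul_top (by simp)]
    exact le_top
  set S := {x | c < maximalFunction m g x}
  have hex : ∀ x ∈ S, ∃ r : ℝ, 0 < r ∧
      m (closedBall x r) ≤ c⁻¹ * ∫⁻ y in closedBall x r, g y ∂m := by
    intro x hx
    obtain ⟨r, hr⟩ := lt_iSup_iff.1 (show c < maximalFunction m g x from hx)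
    have h0 : (0 : ℝ) < r.1 := by exact_mod_cast r.2
    refine ⟨r.1, h0, ?_⟩
    have h1 := measure_closedBall_ne_zero m x h0
    have h2 := measure_closedBall_ne_top m x (r.1 : ℝ)
    calc m (closedBall x (r.1 : ℝ)) = c⁻¹ * (m (closedBall x (r.1 : ℝ)) * c) := by
          rw [mul_comm _ c, ← mul_assoc, ENNReal.inv_mul_cancel hc hc', one_mul]
      _ ≤ c⁻¹ * (m (closedBall x (r.1 : ℝ)) * ((m (closedBall x (r.1 : ℝ)))⁻¹ *
            ∫⁻ y in closedBall x (r.1 : ℝ), g y ∂m)) := by gcongr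
      _ = _ := by rw [← mul_assoc (m _), ENNReal.mul_inv_cancel h1 h2, one_mul]
  choose! r hr0 hr using hex
  set ω := m (closedBall (0 : E) 1)
  have hω : ω ≠ 0 := measure_closedBall_ne_zero m 0 one_pos
  have hω' : ω ≠ ∞ := measure_closedBall_ne_top m 0 1
  set A := c⁻¹ * (∫⁻ y, g y ∂m) / ω
  have hA : A ≠ ∞ := ENNReal.div_ne_top (ENNReal.mul_ne_top (ENNReal.inv_ne_top.2 hc) hI) hω
  -- The Vitali covering lemma needs bounded radii; a radius at least `1` satisfies `r ≤ r ^ n ≤ A`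
  -- by the volume bound.
  have hbd : ∀ x ∈ S, r x ≤ 1 + A.toReal := by
    intro x hx
    rcases le_total (r x) 1 with h | h
    · linarith [A.toReal_nonneg]
    · have h1 : ENNReal.ofReal (r x ^ finrank ℝ E) ≤ A := by
        rw [ENNReal.le_div_iff_mul_le (Or.inl hω) (Or.inl hω'),
          ← measure_closedBall_eq m x (hr0 x hx).le]
        exact (hr x hx).trans (by gcongr; exact Measure.restrict_le_self)
      have h2 := (ENNReal.ofReal_le_iff_le_toReal hA).1 h1
      have h3 : r x ≤ r x ^ finrank ℝ E := le_self_pow₀ h finrank_pos.ne'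
      linarith
  obtain ⟨u, huS, hdisj, hcov⟩ := Vitali.exists_disjoint_subfamily_covering_enlargement_closedBall
    S id r (1 + A.toReal) hbd 5 (by norm_num)
  have hcount : u.Countable := hdisj.countable_of_nonempty_interior fun x hx =>
    ⟨x, ball_subset_interior_closedBall (mem_ball_self (hr0 x (huS hx)))⟩
  calc m S ≤ m (⋃ b ∈ u, closedBall b (5 * r b)) := by
        refine measure_mono fun x hx => ?_
        obtain ⟨b, hb, hsub⟩ := hcov x hx
        exact mem_biUnion hb (hsub (mem_closedBall_self (hr0 x hx).le))
    _ ≤ ∑' b : u, m (closedBall (b : E) (5 * r b)) := measure_biUnion_le m hcount _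
    _ ≤ ∑' b : u, ENNReal.ofReal (5 ^ finrank ℝ E) *
          (c⁻¹ * ∫⁻ y in closedBall (b : E) (r b), g y ∂m) := by
        refine ENNReal.tsum_le_tsum fun b => ?_
        have h0 := hr0 b (huS b.2)
        calc m (closedBall (b : E) (5 * r b))
            = ENNReal.ofReal (5 ^ finrank ℝ E) * m (closedBall (b : E) (r b)) := by
              rw [measure_closedBall_eq m _ (by positivity), measure_closedBall_eq m _ h0.le,
                ← mul_assoc, ← ENNReal.ofReal_mul (by positivity), ← mul_pow]
          _ ≤ _ := by gcongr; exact hr b (huS b.2)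
    _ = ENNReal.ofReal (5 ^ finrank ℝ E) * (c⁻¹ *
          ∫⁻ y in ⋃ b ∈ u, closedBall b (r b), g y ∂m) := by
        rw [lintegral_biUnion (s := fun b => closedBall b (r b)) hcount
          (fun _ _ => measurableSet_closedBall) hdisj,
          ENNReal.tsum_mul_left, ENNReal.tsum_mul_left]
    _ ≤ _ := by gcongr; exact Measure.restrict_le_self

theorem maximalFunction_add_le {g₁ g₂ : E → ℝ≥0∞} (h : Measurable g₁) (x : E) :
    maximalFunction m (fun y => g₁ y + g₂ y) x ≤
      maximalFunction m g₁ x + maximalFunction m g₂ x := by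
  refine iSup_le fun r => ?_
  rw [lintegral_add_left h, mul_add]
  exact add_le_add
    (le_iSup (fun r : {r : ℚ // 0 < r} =>
      (m (closedBall x (r.1 : ℝ)))⁻¹ * ∫⁻ y in closedBall x (r.1 : ℝ), g₁ y ∂m) r)
    (le_iSup (fun r : {r : ℚ // 0 < r} =>
      (m (closedBall x (r.1 : ℝ)))⁻¹ * ∫⁻ y in closedBall x (r.1 : ℝ), g₂ y ∂m) r)

theorem maximalFunction_le_of_le {g : E → ℝ≥0∞} {c : ℝ≥0∞} (h : ∀ y, g y ≤ c) (x : E) :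
    maximalFunction m g x ≤ c := by
  refine iSup_le fun r => ?_
  have h0 : (0 : ℝ) < r.1 := by exact_mod_cast r.2
  calc _ ≤ (m (closedBall x (r.1 : ℝ)))⁻¹ * ∫⁻ y in closedBall x (r.1 : ℝ), c ∂m := by
        gcongr; exact h _
    _ = c := by
      rw [setLIntegral_const, mul_comm c, ← mul_assoc, ENNReal.inv_mul_cancel
        (measure_closedBall_ne_zero m x h0) (measure_closedBall_ne_top m x _), one_mul]

/-- The part of `g` with values at most `c / 2` contributes at most `c / 2` to the maximal function,
so the part above `c / 2` must exceed level `c / 2`. The weak type inequality at that level gives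
the factor `2`. -/
theorem measure_lt_maximalFunction_le_setLIntegral [Nontrivial E] {g : E → ℝ≥0∞}
    (hg : Measurable g) {c : ℝ} (hc : 0 < c) :
    m {x | ENNReal.ofReal c < maximalFunction m g x} ≤
      ENNReal.ofReal (2 * 5 ^ finrank ℝ E) * (ENNReal.ofReal c⁻¹ *
        ∫⁻ y in {y | ENNReal.ofReal (c / 2) < g y}, g y ∂m) := by
  set T := {y | ENNReal.ofReal (c / 2) < g y}
  have hT : MeasurableSet T := measurableSet_lt measurable_const hg
  have hsub : {x | ENNReal.ofReal c < maximalFunction m g x} ⊆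
      {x | ENNReal.ofReal (c / 2) < maximalFunction m (T.indicator g) x} := by
    intro x hx
    by_contra hcon
    have h1 : maximalFunction m (T.indicator g) x ≤ ENNReal.ofReal (c / 2) := not_lt.1 hcon
    have h2 : maximalFunction m (Tᶜ.indicator g) x ≤ ENNReal.ofReal (c / 2) := by
      refine maximalFunction_le_of_le m (fun y => ?_) x
      by_cases hy : y ∈ T
      · simp [hy]
      · simpa [hy] using not_lt.1 hy
    have h3 := maximalFunction_add_le m (g₂ := Tᶜ.indicator g) (hg.indicator hT) x
    have h4 : (fun y => T.indicator g y + Tᶜ.indicator g y) = g :=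
      indicator_self_add_compl T g
    rw [h4] at h3
    have h5 : maximalFunction m g x ≤ ENNReal.ofReal c := by
      refine h3.trans ((add_le_add h1 h2).trans ?_)
      rw [← ENNReal.ofReal_add (by positivity) (by positivity), add_halves]
    exact absurd hx (not_lt.2 h5)
  have hc2 : 0 < c / 2 := by positivity
  calc _ ≤ _ := measure_mono hsub
    _ ≤ _ := measure_lt_maximalFunction_le m _ (by simpa using hc) ENNReal.ofReal_ne_top
    _ = _ := by
      rw [lintegral_indicator hT, ← mul_assoc, ← mul_assoc, ← ENNReal.ofReal_inv_of_pos hc2,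
        ← ENNReal.ofReal_mul (by positivity), ← ENNReal.ofReal_mul (by positivity)]
      congr 2
      field_simp

/-- This is `a^s = ∫_0^a s t^(s-1) dt`, including `a = ∞`. It is the layer-cake formula for a
constant function under a Dirac mass; the infinite case follows by comparison with all finite
values. -/
theorem rpow_eq_lintegral_Ioi (a : ℝ≥0∞) {s : ℝ} (hs : 0 < s) :
    a ^ s = ENNReal.ofReal s * ∫⁻ t in Ioi (0 : ℝ),
      {t : ℝ | ENNReal.ofReal t < a}.indicator (fun t => ENNReal.ofReal (t ^ (s - 1))) t := by
  have key : ∀ b : ℝ, 0 ≤ b → ENNReal.ofReal b ^ s = ENNReal.ofReal s * ∫⁻ t in Ioi (0 : ℝ),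
      {t : ℝ | ENNReal.ofReal t < ENNReal.ofReal b}.indicator
        (fun t => ENNReal.ofReal (t ^ (s - 1))) t := by
    intro b hb
    have h := lintegral_rpow_eq_lintegral_meas_lt_mul (Measure.dirac ())
      (f := fun _ => b) (Filter.Eventually.of_forall fun _ => hb) aemeasurable_const hs
    rw [lintegral_dirac, ← ENNReal.ofReal_rpow_of_nonneg hb hs.le] at h
    rw [h]
    congr 1
    refine setLIntegral_congr_fun measurableSet_Ioi fun t ht => ?_
    have ht0 : 0 < t := ht
    by_cases htb : t < b
    · have : ENNReal.ofReal t < ENNReal.ofReal b := by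
        rwa [ENNReal.ofReal_lt_ofReal_iff_of_nonneg ht0.le]
      simp [htb, this]
    · have : ¬ ENNReal.ofReal t < ENNReal.ofReal b := by
        rwa [ENNReal.ofReal_lt_ofReal_iff_of_nonneg ht0.le]
      simp [htb, this]
  by_cases ha : a = ∞
  · subst ha
    rw [ENNReal.top_rpow_of_pos hs]
    refine (ENNReal.eq_top_of_forall_nnreal_le fun b => ?_).symm
    have hb : (b : ℝ≥0∞) = ENNReal.ofReal ((b : ℝ) ^ (s⁻¹)) ^ s := by
      rw [ENNReal.ofReal_rpow_of_nonneg (by positivity) hs.le, Real.rpow_inv_rpow b.coe_nonneg hs.ne',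
        ENNReal.ofReal_coe_nnreal]
    rw [hb, key _ (by positivity)]
    gcongr
    exact le_top
  · rw [← ENNReal.ofReal_toReal ha]
    exact key _ a.toReal_nonneg

theorem measurable_indicator_lt {g : E → ℝ≥0∞} (hg : Measurable g) {c : ℝ → ℝ≥0∞}
    (hc : Measurable c) {k : ℝ → ℝ≥0∞} (hk : Measurable k) :
    Measurable (fun z : E × ℝ => {t : ℝ | c t < g z.1}.indicator k z.2) :=
  (hk.comp measurable_snd).indicator (s := {z : E × ℝ | c z.2 < g z.1})
    (measurableSet_lt (hc.comp measurable_snd) (hg.comp measurable_fst))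

theorem lintegral_rpow_eq_lintegral_measure_lt {g : E → ℝ≥0∞} (hg : Measurable g) {s : ℝ}
    (hs : 0 < s) :
    ∫⁻ x, g x ^ s ∂m = ENNReal.ofReal s * ∫⁻ t in Ioi (0 : ℝ),
      ENNReal.ofReal (t ^ (s - 1)) * m {x | ENNReal.ofReal t < g x} := by
  simp_rw [fun x => rpow_eq_lintegral_Ioi (g x) hs]
  have hk : Measurable fun t : ℝ => ENNReal.ofReal (t ^ (s - 1)) := by fun_prop
  rw [lintegral_const_mul' _ _ ENNReal.ofReal_ne_top, lintegral_lintegral_swap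
    (measurable_indicator_lt hg ENNReal.measurable_ofReal hk).aemeasurable]
  congr 1
  refine lintegral_congr fun t => ?_
  have : ∀ x, {t : ℝ | ENNReal.ofReal t < g x}.indicator (fun t => ENNReal.ofReal (t ^ (s - 1))) t
      = {x | ENNReal.ofReal t < g x}.indicator (fun _ => ENNReal.ofReal (t ^ (s - 1))) x :=
    fun x => rfl
  simp_rw [this]
  rw [lintegral_indicator_const (measurableSet_lt measurable_const hg)]

/-- The Hardy–Littlewood maximal theorem. -/
theorem exists_lintegral_maximalFunction_rpow_le [Nontrivial E] {p : ℝ} (hp : 1 < p) :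
    ∃ C : ℝ≥0, ∀ g : E → ℝ≥0∞, Measurable g →
      ∫⁻ x, maximalFunction m g x ^ p ∂m ≤ C * ∫⁻ x, g x ^ p ∂m := by
  set D : ℝ := 2 * 5 ^ finrank ℝ E
  refine ⟨Real.toNNReal (p * (D * ((p - 1)⁻¹ * 2 ^ (p - 1)))), fun g hg => ?_⟩
  have hp1 : 0 < p - 1 := by linarith
  have hk : Measurable fun t : ℝ => ENNReal.ofReal (t ^ (p - 2)) := by fun_prop
  -- The integral over levels that remains after Tonelli. It converges at `0` because `p > 1`, and
  -- it supplies the factor `2^(p-1) / (p-1)` of the constant.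
  have hinner : ∀ a : ℝ≥0∞, ∫⁻ t in Ioi (0 : ℝ), {t : ℝ | ENNReal.ofReal (t / 2) < a}.indicator
      (fun t => ENNReal.ofReal (t ^ (p - 2))) t =
      ENNReal.ofReal ((p - 1)⁻¹ * 2 ^ (p - 1)) * a ^ (p - 1) := by
    intro a
    have h1 := rpow_eq_lintegral_Ioi (2 * a) hp1
    rw [ENNReal.mul_rpow_of_nonneg _ _ hp1.le] at h1
    have h2 : ∀ t : ℝ, (ENNReal.ofReal t < 2 * a) ↔ (ENNReal.ofReal (t / 2) < a) := by
      intro t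
      rw [ENNReal.ofReal_div_of_pos two_pos, ENNReal.div_lt_iff (by simp) (by simp), mul_comm]
      simp
    simp_rw [h2, show p - 1 - 1 = p - 2 by ring] at h1
    rw [ENNReal.ofReal_mul (by positivity), mul_assoc, ← ENNReal.ofReal_rpow_of_pos two_pos,
      ENNReal.ofReal_ofNat, h1, ← mul_assoc, ← ENNReal.ofReal_mul (by positivity),
      inv_mul_cancel₀ hp1.ne', ENNReal.ofReal_one, one_mul]
  calc ∫⁻ x, maximalFunction m g x ^ p ∂m
      = ENNReal.ofReal p * ∫⁻ t in Ioi (0 : ℝ),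
      ENNReal.ofReal (t ^ (p - 1)) * m {x | ENNReal.ofReal t < maximalFunction m g x} :=
        lintegral_rpow_eq_lintegral_measure_lt m (measurable_maximalFunction m hg) (by linarith)
    _ ≤ ENNReal.ofReal p * ∫⁻ t in Ioi (0 : ℝ), ENNReal.ofReal D *
          ∫⁻ y, {t : ℝ | ENNReal.ofReal (t / 2) < g y}.indicator
            (fun t => ENNReal.ofReal (t ^ (p - 2))) t * g y ∂m := by
        gcongr ENNReal.ofReal p * ?_
        refine setLIntegral_mono' measurableSet_Ioi fun t ht => ?_
        have ht0 : 0 < t := ht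
        have hT : MeasurableSet {y | ENNReal.ofReal (t / 2) < g y} :=
          measurableSet_lt measurable_const hg
        calc _ ≤ ENNReal.ofReal (t ^ (p - 1)) * (ENNReal.ofReal D * (ENNReal.ofReal t⁻¹ *
                ∫⁻ y in {y | ENNReal.ofReal (t / 2) < g y}, g y ∂m)) := by
              gcongr
              exact measure_lt_maximalFunction_le_setLIntegral m hg ht0
          _ = ENNReal.ofReal D * (ENNReal.ofReal (t ^ (p - 2)) *
                ∫⁻ y in {y | ENNReal.ofReal (t / 2) < g y}, g y ∂m) := by
              have : t ^ (p - 2) = t ^ (p - 1) * t⁻¹ := by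
                rw [← Real.rpow_neg_one t, ← Real.rpow_add ht0]; ring_nf
              rw [this, ENNReal.ofReal_mul (p := t ^ (p - 1)) (by positivity)]
              ring
          _ = _ := by
              rw [← lintegral_const_mul' _ _ ENNReal.ofReal_ne_top, ← lintegral_indicator hT]
              congr 1
              refine lintegral_congr fun y => ?_
              by_cases hy : ENNReal.ofReal (t / 2) < g y <;> simp [hy]
    _ = ENNReal.ofReal p * (ENNReal.ofReal D * ∫⁻ y, (∫⁻ t in Ioi (0 : ℝ),
          {t : ℝ | ENNReal.ofReal (t / 2) < g y}.indicator
            (fun t => ENNReal.ofReal (t ^ (p - 2))) t) * g y ∂m) := by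
        have hmeas := measurable_indicator_lt hg
          (ENNReal.measurable_ofReal.comp (measurable_id.div_const 2)) hk
        rw [lintegral_const_mul' _ _ ENNReal.ofReal_ne_top, lintegral_lintegral_swap]
        · congr 2
          refine lintegral_congr fun y => ?_
          rw [lintegral_mul_const]
          exact hmeas.comp measurable_prodMk_left
        · exact ((hmeas.comp measurable_swap).mul (hg.comp measurable_snd)).aemeasurable
    _ = _ := by
        simp_rw [hinner, mul_assoc]
        rw [lintegral_const_mul' _ _ ENNReal.ofReal_ne_top, ← mul_assoc, ← mul_assoc,
          ← ENNReal.ofReal_mul (by positivity), ← ENNReal.ofReal_mul (by positivity),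
          mul_assoc p]
        congr 1
        refine lintegral_congr fun y => ?_
        nth_rw 2 [← ENNReal.rpow_one (g y)]
        rw [← ENNReal.rpow_add_of_nonneg _ _ hp1.le zero_le_one]
        ring_nf

end HardyLittlewood

/-! ### Nontangential domination of radial averages by the maximal function. -/

namespace HardyLittlewood

open Metric Module Set

set_option linter.unusedSectionVars false

variable {E : Type*} [NormedAddCommGroup E] [NormedSpace ℝ E] [FiniteDimensional ℝ E]
  [MeasurableSpace E] [BorelSpace E]

/-- Such a function is a monotone profile along one ray composed with the norm; `max ρ 0` extends
the profile antitonically to negative `ρ`. -/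
theorem measurable_of_norm_antitone [Nontrivial E] {φ : E → ℝ}
    (hφ : ∀ x y, ‖x‖ ≤ ‖y‖ → φ y ≤ φ x) : Measurable φ := by
  obtain ⟨e, he⟩ := exists_norm_eq E zero_le_one
  have h : Antitone fun ρ : ℝ => φ (max ρ 0 • e) := by
    intro a b hab
    refine hφ _ _ ?_
    simp only [norm_smul, he, mul_one, Real.norm_eq_abs]
    rw [abs_of_nonneg (le_max_right _ _), abs_of_nonneg (le_max_right _ _)]
    exact max_le_max_right 0 hab
  have h2 : φ = (fun ρ : ℝ => φ (max ρ 0 • e)) ∘ fun x => ‖x‖ := by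
    funext x
    have hx : ‖max ‖x‖ 0 • e‖ = ‖x‖ := by simp [norm_smul, he]
    exact le_antisymm (hφ _ _ hx.le) (hφ _ _ hx.ge)
  rw [h2]
  exact h.measurable.comp measurable_norm

variable (m : Measure E) [m.IsAddHaarMeasure]

/-- A superlevel set of a radially non-increasing function lies in the centred ball whose
volume is that of the set. -/
theorem norm_le_of_lt_of_norm_antitone [Nontrivial E] {φ : E → ℝ}
    (hφ : ∀ x y, ‖x‖ ≤ ‖y‖ → φ y ≤ φ x) {s : ℝ} (hs : m {w | s < φ w} ≠ ∞) {w : E}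
    (hw : s < φ w) :
    ‖w‖ ≤ (m {w | s < φ w} / m (closedBall 0 1)).toReal ^ ((finrank ℝ E : ℝ)⁻¹) := by
  have hω := measure_closedBall_ne_zero m (0 : E) one_pos
  have hω' := measure_closedBall_ne_top m (0 : E) 1
  have h1 : m (closedBall 0 ‖w‖) ≤ m {w | s < φ w} :=
    measure_mono fun v hv => hw.trans_le (hφ _ _ (by simpa using hv))
  rw [measure_closedBall_eq m _ (norm_nonneg w), ← ENNReal.le_div_iff_mul_le (Or.inl hω)
    (Or.inl hω'), ENNReal.ofReal_le_iff_le_toReal (ENNReal.div_ne_top hs hω)] at h1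
  have hd : finrank ℝ E ≠ 0 := finrank_pos.ne'
  calc ‖w‖ = (‖w‖ ^ finrank ℝ E) ^ ((finrank ℝ E : ℝ)⁻¹) :=
        (Real.pow_rpow_inv_natCast (norm_nonneg w) hd).symm
    _ ≤ _ := by gcongr

/-- If `R` is the volume radius of the superlevel set, its dilated translate lies in the ball of
radius `t R` about `y`, hence in that of radius `t (R + 1)` about `x`. By `(R + 1)^n ≤ 2^n (R^n +
1)`, the shift costs one extra unit-ball volume, and only at levels `s < φ 0`, where the set is
nonempty. The other `2^n` in `4^n` comes from rational radii. -/
theorem setLIntegral_dilated_superlevel_le [Nontrivial E] {φ : E → ℝ}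
    (hφ : ∀ x y, ‖x‖ ≤ ‖y‖ → φ y ≤ φ x) (g : E → ℝ≥0∞) {x y : E} {t s : ℝ} (ht : 0 < t)
    (hxy : dist y x ≤ t) (hs : m {w | s < φ w} ≠ ∞) :
    ∫⁻ z in {z | s < φ (t⁻¹ • (y - z))}, g z ∂m ≤
      ENNReal.ofReal (4 ^ finrank ℝ E) *
        (m {w | s < φ w} + (Iio (φ 0)).indicator (fun _ => m (closedBall 0 1)) s) *
          (ENNReal.ofReal (t ^ finrank ℝ E) * maximalFunction m g x) := by
  by_cases h0 : s < φ 0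
  · set n := finrank ℝ E
    set ω := m (closedBall (0 : E) 1)
    have hω : ω ≠ 0 := measure_closedBall_ne_zero m (0 : E) one_pos
    have hω' : ω ≠ ∞ := measure_closedBall_ne_top m (0 : E) 1
    set v := m {w | s < φ w}
    set R := (v / ω).toReal ^ ((n : ℝ)⁻¹)
    have hR : 0 ≤ R := by positivity
    have hRn : R ^ n = (v / ω).toReal :=
      Real.rpow_inv_natCast_pow ENNReal.toReal_nonneg (finrank_pos (R := ℝ) (M := E)).ne'
    have hsub : {z | s < φ (t⁻¹ • (y - z))} ⊆ closedBall x (t * (R + 1)) := by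
      intro z hz
      have h1 := norm_le_of_lt_of_norm_antitone m hφ hs hz
      rw [norm_smul, norm_inv, Real.norm_of_nonneg ht.le, inv_mul_le_iff₀ ht, ← dist_eq_norm] at h1
      rw [mem_closedBall]
      calc dist z x ≤ dist y z + dist y x := by rw [dist_comm y z]; exact dist_triangle _ _ _
        _ ≤ t * R + t := add_le_add h1 hxy
        _ = _ := by ring
    have hvol : m (closedBall x (t * (R + 1))) ≤
        ENNReal.ofReal (t ^ n) * (ENNReal.ofReal (2 ^ n) * (v + ω)) := by
      have h2 : (R + 1) ^ n ≤ 2 ^ n * (R ^ n + 1) := by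
        refine (add_pow_le hR zero_le_one n).trans ?_
        rw [one_pow]
        gcongr
        · norm_num
        · exact Nat.sub_le _ _
      rw [measure_closedBall_eq m x (by positivity), mul_pow, ENNReal.ofReal_mul (by positivity),
        mul_assoc]
      gcongr ENNReal.ofReal (t ^ n) * ?_
      calc ENNReal.ofReal ((R + 1) ^ n) * ω ≤ ENNReal.ofReal (2 ^ n * (R ^ n + 1)) * ω := by gcongr
        _ = ENNReal.ofReal (2 ^ n) * (v + ω) := by
          rw [ENNReal.ofReal_mul (by positivity), ENNReal.ofReal_add (by positivity) zero_le_one,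
            hRn, ENNReal.ofReal_toReal (ENNReal.div_ne_top hs hω), ENNReal.ofReal_one, mul_assoc,
            add_mul, one_mul, ENNReal.div_mul_cancel hω hω']
    rw [indicator_of_mem (show s ∈ Iio (φ 0) from h0)]
    calc ∫⁻ z in {z | s < φ (t⁻¹ • (y - z))}, g z ∂m
        ≤ ∫⁻ z in closedBall x (t * (R + 1)), g z ∂m := lintegral_mono_set hsub
      _ ≤ _ := setLIntegral_closedBall_le_mul_maximalFunction m g x (by positivity)
      _ ≤ ENNReal.ofReal (2 ^ n) * (ENNReal.ofReal (t ^ n) * (ENNReal.ofReal (2 ^ n) * (v + ω)))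
            * maximalFunction m g x := by gcongr
      _ = _ := by
        rw [show (4 : ℝ) ^ n = 2 ^ n * 2 ^ n by rw [← mul_pow]; norm_num,
          ENNReal.ofReal_mul (by positivity)]
        ring
  · have : {z | s < φ (t⁻¹ • (y - z))} = ∅ := by
      refine eq_empty_of_forall_notMem fun z hz => h0 (lt_of_lt_of_le hz (hφ _ _ ?_))
      simp
    simp [this]

/-- Averages against dilates of a radially non-increasing integrable function are dominated by the
maximal function, nontangentially. -/
theorem lintegral_radial_mul_le [Nontrivial E] {φ : E → ℝ}
    (hφ : ∀ x y, ‖x‖ ≤ ‖y‖ → φ y ≤ φ x) (hφ0 : ∀ x, 0 ≤ φ x) {g : E → ℝ≥0∞}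
    (hg : Measurable g) {x y : E} {t : ℝ} (ht : 0 < t) (hxy : dist y x ≤ t) :
    ∫⁻ z, ENNReal.ofReal (φ (t⁻¹ • (y - z))) * g z ∂m ≤
      ENNReal.ofReal (4 ^ finrank ℝ E) *
        (∫⁻ w, ENNReal.ofReal (φ w) ∂m + ENNReal.ofReal (φ 0) * m (closedBall 0 1)) *
          (ENNReal.ofReal (t ^ finrank ℝ E) * maximalFunction m g x) := by
  have hmeas := measurable_of_norm_antitone hφ
  -- If `φ` is not integrable, the right side is infinite unless the maximal function vanishes at
  -- `x`, which forces `g = 0` almost everywhere.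
  by_cases hfin : ∫⁻ w, ENNReal.ofReal (φ w) ∂m = ∞
  · by_cases hM : maximalFunction m g x = 0
    · have h1 : ∀ n : ℕ, ∫⁻ z in closedBall x n, g z ∂m = 0 := by
        intro n
        rcases Nat.eq_zero_or_pos n with h | h
        · subst h; simp
        · have := setLIntegral_closedBall_le_mul_maximalFunction m g x
            (show (0 : ℝ) < n by exact_mod_cast h)
          rw [hM, mul_zero] at this
          exact le_antisymm this zero_le
      have h2 : ∫⁻ z, g z ∂m = 0 := by
        rw [← setLIntegral_univ, ← iUnion_closedBall_nat x]
        exact le_antisymm ((lintegral_iUnion_le _ _).trans (by simp [h1])) zero_le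
      have h3 : g =ᵐ[m] 0 := (lintegral_eq_zero_iff hg).1 h2
      have h4 : ∫⁻ z, ENNReal.ofReal (φ (t⁻¹ • (y - z))) * g z ∂m = 0 := by
        rw [← lintegral_zero (μ := m)]
        refine lintegral_congr_ae (h3.mono fun z hz => ?_)
        simp [hz]
      rw [h4]; exact zero_le
    · rw [hfin, top_add, ENNReal.mul_top (by simp), ENNReal.top_mul]
      · exact le_top
      · exact mul_ne_zero (by simpa using pow_pos ht _) hM
  have hlev : ∀ s : ℝ, 0 < s → m {w | s < φ w} ≠ ∞ := by
    intro s hs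
    refine ((measure_mono fun w hw => ?_).trans_lt
      (meas_ge_le_lintegral_div (μ := m) (hmeas.ennreal_ofReal).aemeasurable
        (ε := ENNReal.ofReal s) (by simpa using hs) ENNReal.ofReal_ne_top |>.trans_lt
        (ENNReal.div_lt_top hfin (by simpa using hs)))).ne
    exact ENNReal.ofReal_le_ofReal (le_of_lt hw)
  have hcomp : Measurable fun z => φ (t⁻¹ • (y - z)) :=
    hmeas.comp ((measurable_const.sub measurable_id).const_smul _)
  -- Layer-cake formula in `φ` for the measure with density `g`.
  have h1 : ∫⁻ z, ENNReal.ofReal (φ (t⁻¹ • (y - z))) * g z ∂m =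
      ∫⁻ s in Ioi (0 : ℝ), ∫⁻ z in {z | s < φ (t⁻¹ • (y - z))}, g z ∂m := by
    rw [show (∫⁻ z, ENNReal.ofReal (φ (t⁻¹ • (y - z))) * g z ∂m) =
      ∫⁻ z, ENNReal.ofReal (φ (t⁻¹ • (y - z))) ∂(m.withDensity g) by
        rw [lintegral_withDensity_eq_lintegral_mul _ hg hcomp.ennreal_ofReal]
        exact lintegral_congr fun z => mul_comm _ _]
    rw [lintegral_eq_lintegral_meas_lt _ (Filter.Eventually.of_forall fun _ => hφ0 _)
      hcomp.aemeasurable]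
    refine lintegral_congr fun s => ?_
    rw [withDensity_apply _ (measurableSet_lt measurable_const hcomp)]
  have h2 : ∫⁻ s in Ioi (0 : ℝ), (m {w | s < φ w} +
      (Iio (φ 0)).indicator (fun _ => m (closedBall 0 1)) s) =
      ∫⁻ w, ENNReal.ofReal (φ w) ∂m + ENNReal.ofReal (φ 0) * m (closedBall 0 1) := by
    rw [lintegral_add_right _ (measurable_const.indicator measurableSet_Iio),
      ← lintegral_eq_lintegral_meas_lt _ (Filter.Eventually.of_forall hφ0) hmeas.aemeasurable,
      lintegral_indicator_const measurableSet_Iio, Measure.restrict_apply measurableSet_Iio,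
      inter_comm, Ioi_inter_Iio, Real.volume_Ioo, sub_zero, mul_comm]
  rw [h1, ← h2]
  have hC : ENNReal.ofReal (4 ^ finrank ℝ E) ≠ ∞ := ENNReal.ofReal_ne_top
  have hm2 : Measurable fun s : ℝ => (m {w | s < φ w} +
      (Iio (φ 0)).indicator (fun _ => m (closedBall 0 1)) s) := by
    refine Measurable.add ?_ (measurable_const.indicator measurableSet_Iio)
    exact Antitone.measurable fun a b hab => measure_mono fun w hw => lt_of_le_of_lt hab hw
  rw [← lintegral_const_mul _ hm2, ← lintegral_mul_const _ (hm2.const_mul _)]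
  exact setLIntegral_mono' measurableSet_Ioi fun s hs =>
    setLIntegral_dilated_superlevel_le m hφ g ht hxy (hlev s hs)

end HardyLittlewood

/-! ### Differentiation of convolutions under the integral sign. -/

namespace HalfSpace

open Metric Module Set Filter Topology CarlesonMeasure

set_option linter.unusedSectionVars false

section Parametric

variable {X F : Type*} [NormedAddCommGroup X] [NormedSpace ℝ X] [FiniteDimensional ℝ X]
  [MeasurableSpace X] [BorelSpace X] [NormedAddCommGroup F] [NormedSpace ℝ F]

theorem isOpen_upperHalf : IsOpen {z : X × ℝ | 0 < z.2} :=
  isOpen_lt continuous_const continuous_snd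

/-- The integral `∫ g(y) G(x - y, t) dy` as a function of `z = (x, t)`. -/
noncomputable def convKernel (m : Measure X) (g : X → ℝ) (G : X × ℝ → F) (z : X × ℝ) : F :=
  ∫ y, g y • G (z.1 - y, z.2) ∂m

theorem continuous_comp_sub {G : X × ℝ → F} (hG : ContinuousOn G {z | 0 < z.2}) {z : X × ℝ}
    (hz : 0 < z.2) : Continuous fun y => G (z.1 - y, z.2) :=
  hG.comp_continuous (by fun_prop) fun _ => hz

theorem exists_bound_translates {G : X × ℝ → F} (hG : ContinuousOn G {z | 0 < z.2}) {z₀ : X × ℝ}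
    (hz₀ : 0 < z₀.2) (R : ℝ) :
    ∃ C, 0 ≤ C ∧ ∀ z ∈ ball z₀ z₀.2 ∩ closedBall z₀ (z₀.2 / 2), ∀ y ∈ closedBall (0 : X) R,
      ‖G (z.1 - y, z.2)‖ ≤ C := by
  have hsnd : ∀ z ∈ closedBall z₀ (z₀.2 / 2), 0 < z.2 := by
    intro z hz
    have h1 : dist z.2 z₀.2 ≤ z₀.2 / 2 := (le_max_right _ _).trans (mem_closedBall.1 hz)
    rw [Real.dist_eq, abs_le] at h1
    linarith [h1.1]
  have hK : IsCompact (closedBall z₀ (z₀.2 / 2) ×ˢ closedBall (0 : X) R) :=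
    (isCompact_closedBall _ _).prod (isCompact_closedBall _ _)
  have hc : ContinuousOn (fun w : (X × ℝ) × X => G (w.1.1 - w.2, w.1.2))
      (closedBall z₀ (z₀.2 / 2) ×ˢ closedBall (0 : X) R) :=
    hG.comp (by fun_prop) fun w hw => hsnd w.1 hw.1
  obtain ⟨C, hC⟩ := hK.exists_bound_of_continuousOn hc
  exact ⟨max C 0, le_max_right _ _, fun z hz y hy => (hC (z, y) ⟨hz.2, hy⟩).trans (le_max_left _ _)⟩

variable {m : Measure X} [IsFiniteMeasureOnCompacts m] {g : X → ℝ} {B R : ℝ}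

/-- Since `g` is bounded and vanishes off a ball, a multiple of the indicator of that ball dominates
the integrand for all `z` near `z₀`. This one bound serves for continuity and for each derivative.
-/
theorem exists_integrable_bound {G : X × ℝ → F} (hG : ContinuousOn G {z | 0 < z.2})
    (hgB : ∀ y, |g y| ≤ B) (hgR : ∀ y, y ∉ closedBall (0 : X) R → g y = 0)
    {z₀ : X × ℝ} (hz₀ : 0 < z₀.2) :
    ∃ b : X → ℝ, Integrable b m ∧ ∃ s ∈ 𝓝 z₀, s ⊆ {z | 0 < z.2} ∧ ∀ z ∈ s, ∀ y,
      ‖g y • G (z.1 - y, z.2)‖ ≤ b y := by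
  obtain ⟨C, hC0, hC⟩ := exists_bound_translates hG hz₀ R
  refine ⟨(closedBall (0 : X) R).indicator fun _ => B * C, ?_,
    ball z₀ z₀.2 ∩ closedBall z₀ (z₀.2 / 2), ?_, ?_, ?_⟩
  · exact (integrable_indicator_iff measurableSet_closedBall).2
      (integrableOn_const (isCompact_closedBall _ _).measure_lt_top.ne)
  · exact inter_mem (ball_mem_nhds _ hz₀) (closedBall_mem_nhds _ (by positivity))
  · rintro z ⟨-, hz⟩
    have h1 : dist z.2 z₀.2 ≤ z₀.2 / 2 := (le_max_right _ _).trans (mem_closedBall.1 hz)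
    rw [Real.dist_eq, abs_le] at h1
    show 0 < z.2
    linarith [h1.1]
  · intro z hz y
    by_cases hy : y ∈ closedBall (0 : X) R
    · rw [indicator_of_mem hy, norm_smul]
      exact mul_le_mul (hgB y) (hC z hz y hy) (norm_nonneg _) ((abs_nonneg _).trans (hgB y))
    · rw [indicator_of_notMem hy, hgR y hy]; simp

theorem integrable_convKernel {G : X × ℝ → F} (hG : ContinuousOn G {z | 0 < z.2})
    (hg : Measurable g) (hgB : ∀ y, |g y| ≤ B) (hgR : ∀ y, y ∉ closedBall (0 : X) R → g y = 0)
    {z : X × ℝ} (hz : 0 < z.2) : Integrable (fun y => g y • G (z.1 - y, z.2)) m := by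
  obtain ⟨b, hb, s, hs, -, hbd⟩ := exists_integrable_bound (m := m) hG hgB hgR hz
  exact hb.mono' (hg.aestronglyMeasurable.smul (continuous_comp_sub hG hz).aestronglyMeasurable)
    (Eventually.of_forall (hbd z (mem_of_mem_nhds hs)))

theorem continuousOn_convKernel {G : X × ℝ → F} (hG : ContinuousOn G {z | 0 < z.2})
    (hg : Measurable g) (hgB : ∀ y, |g y| ≤ B) (hgR : ∀ y, y ∉ closedBall (0 : X) R → g y = 0) :
    ContinuousOn (convKernel m g G) {z | 0 < z.2} := by
  intro z hz
  obtain ⟨b, hb, s, hs, hsU, hbd⟩ := exists_integrable_bound (m := m) hG hgB hgR hz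
  refine (continuousAt_of_dominated (bound := b) ?_ ?_ hb ?_).continuousWithinAt
  · filter_upwards [hs] with w hw
    exact hg.aestronglyMeasurable.smul (continuous_comp_sub hG (hsU hw)).aestronglyMeasurable
  · filter_upwards [hs] with w hw
    exact Eventually.of_forall (hbd w hw)
  · refine Eventually.of_forall fun y => ContinuousAt.const_smul ?_ _
    have h1 : ContinuousAt G (z.1 - y, z.2) := hG.continuousAt (isOpen_upperHalf.mem_nhds hz)
    exact h1.comp_of_eq (f := fun w : X × ℝ => (w.1 - y, w.2)) (by fun_prop) rfl

/-- The derivative is again a `convKernel`, with values in a space of linear maps; as `F` is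
arbitrary, the lemma can be iterated. -/
theorem hasFDerivAt_convKernel {G : X × ℝ → F} {G' : X × ℝ → X × ℝ →L[ℝ] F}
    (hG : ∀ z : X × ℝ, 0 < z.2 → HasFDerivAt G (G' z) z) (hG' : ContinuousOn G' {z | 0 < z.2})
    (hg : Measurable g) (hgB : ∀ y, |g y| ≤ B) (hgR : ∀ y, y ∉ closedBall (0 : X) R → g y = 0)
    {z : X × ℝ} (hz : 0 < z.2) :
    HasFDerivAt (convKernel m g G) (convKernel m g G' z) z := by
  have hGc : ContinuousOn G {z | 0 < z.2} :=
    fun w hw => (hG w hw).continuousAt.continuousWithinAt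
  obtain ⟨b, hb, s, hs, hsU, hbd⟩ := exists_integrable_bound (m := m) hG' hgB hgR hz
  refine hasFDerivAt_integral_of_dominated_of_fderiv_le (bound := b) (𝕜 := ℝ) hs
    (F' := fun z y => g y • G' (z.1 - y, z.2)) ?_ ?_ ?_ ?_ hb ?_
  · filter_upwards [hs] with w hw
    exact hg.aestronglyMeasurable.smul (continuous_comp_sub hGc (hsU hw)).aestronglyMeasurable
  · exact integrable_convKernel hGc hg hgB hgR hz
  · exact hg.aestronglyMeasurable.smul (continuous_comp_sub hG' hz).aestronglyMeasurable
  · exact Eventually.of_forall fun y w hw => hbd w hw y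
  · refine Eventually.of_forall fun y w hw => HasFDerivAt.const_smul ?_ _
    have h1 : HasFDerivAt (fun w : X × ℝ => (w.1 - y, w.2)) 
        ((ContinuousLinearMap.fst ℝ X ℝ).prod (ContinuousLinearMap.snd ℝ X ℝ)) w :=
      (hasFDerivAt_fst.sub_const y).prodMk hasFDerivAt_snd
    rw [ContinuousLinearMap.fst_prod_snd] at h1
    exact HasFDerivAt.comp w (g := G) (hG (w.1 - y, w.2) (show 0 < w.2 from hsU hw)) h1

theorem contDiffOn_two_iff {G : X × ℝ → F} :
    ContDiffOn ℝ 2 G {z | 0 < z.2} ↔ DifferentiableOn ℝ G {z | 0 < z.2} ∧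
      DifferentiableOn ℝ (fderiv ℝ G) {z | 0 < z.2} ∧
      ContinuousOn (fderiv ℝ (fderiv ℝ G)) {z | 0 < z.2} := by
  rw [show (2 : WithTop ℕ∞) = 1 + 1 by norm_num, contDiffOn_succ_iff_fderiv_of_isOpen
    isOpen_upperHalf, show (1 : WithTop ℕ∞) = 0 + 1 by norm_num,
    contDiffOn_succ_iff_fderiv_of_isOpen isOpen_upperHalf, contDiffOn_zero]
  simp

theorem fderiv_convKernel {G : X × ℝ → F} (hG : ContDiffOn ℝ 2 G {z | 0 < z.2})
    (hg : Measurable g) (hgB : ∀ y, |g y| ≤ B) (hgR : ∀ y, y ∉ closedBall (0 : X) R → g y = 0) :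
    ContDiffOn ℝ 2 (convKernel m g G) {z | 0 < z.2} ∧ ∀ z : X × ℝ, 0 < z.2 →
      fderiv ℝ (fderiv ℝ (convKernel m g G)) z =
        convKernel m g (fderiv ℝ (fderiv ℝ G)) z := by
  obtain ⟨h1, h2, h3⟩ := contDiffOn_two_iff.1 hG
  have d1 : ∀ z : X × ℝ, 0 < z.2 → HasFDerivAt G (fderiv ℝ G z) z := fun z hz =>
    (h1.differentiableAt (isOpen_upperHalf.mem_nhds hz)).hasFDerivAt
  have d2 : ∀ z : X × ℝ, 0 < z.2 → HasFDerivAt (fderiv ℝ G) (fderiv ℝ (fderiv ℝ G) z) z :=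
    fun z hz => (h2.differentiableAt (isOpen_upperHalf.mem_nhds hz)).hasFDerivAt
  have e1 : ∀ z : X × ℝ, 0 < z.2 →
      HasFDerivAt (convKernel m g G) (convKernel m g (fderiv ℝ G) z) z :=
    fun z hz => hasFDerivAt_convKernel d1 h2.continuousOn hg hgB hgR hz
  have e2 : ∀ z : X × ℝ, 0 < z.2 → HasFDerivAt (fderiv ℝ (convKernel m g G))
      (convKernel m g (fderiv ℝ (fderiv ℝ G)) z) z := by
    intro z hz
    refine (hasFDerivAt_convKernel d2 h3 hg hgB hgR hz).congr_of_eventuallyEq ?_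
    filter_upwards [isOpen_upperHalf.mem_nhds hz] with w hw using (e1 w hw).fderiv
  refine ⟨contDiffOn_two_iff.2 ⟨fun z hz => (e1 z hz).differentiableAt.differentiableWithinAt,
    fun z hz => (e2 z hz).differentiableAt.differentiableWithinAt, ?_⟩,
    fun z hz => (e2 z hz).fderiv⟩
  exact (continuousOn_convKernel h3 hg hgB hgR).congr fun z hz => (e2 z hz).fderiv

/-- Reduces diagonal values of the Hessian to one-variable calculus on a line. -/
theorem fderiv_fderiv_apply_eq_of_line {V : Type*} [NormedAddCommGroup V] [NormedSpace ℝ V]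
    {G : V → F} {z v : V} (hG : ∀ᶠ w in 𝓝 z, DifferentiableAt ℝ G w)
    (hG' : DifferentiableAt ℝ (fderiv ℝ G) z) {h₁ : ℝ → F} {h₂ : F}
    (hh₁ : ∀ᶠ s in 𝓝 (0 : ℝ), HasDerivAt (fun s : ℝ => G (z + s • v)) (h₁ s) s)
    (hh₂ : HasDerivAt h₁ h₂ 0) : fderiv ℝ (fderiv ℝ G) z v v = h₂ := by
  have hl : ∀ s : ℝ, HasDerivAt (fun s : ℝ => z + s • v) v s := fun s => by
    simpa using ((hasDerivAt_id s).smul_const v).const_add z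
  have hc : Tendsto (fun s : ℝ => z + s • v) (𝓝 0) (𝓝 z) := by
    have := (hl 0).continuousAt.tendsto
    simpa using this
  have h3 : h₁ =ᶠ[𝓝 0] fun s => fderiv ℝ G (z + s • v) v := by
    filter_upwards [hh₁, hc.eventually hG] with s hs hs'
    exact hs.unique (hs'.hasFDerivAt.comp_hasDerivAt s (hl s))
  have h4 : HasDerivAt (fun s : ℝ => fderiv ℝ G (z + s • v)) (fderiv ℝ (fderiv ℝ G) z v) 0 :=
    HasFDerivAt.comp_hasDerivAt_of_eq 0 hG'.hasFDerivAt (hl 0) (by simp)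
  have h5 : HasDerivAt (fun s : ℝ => fderiv ℝ G (z + s • v) v) (fderiv ℝ (fderiv ℝ G) z v v) 0 := by
    simpa using h4.clm_apply (hasDerivAt_const 0 v)
  exact (h5.congr_of_eventuallyEq h3).unique hh₂

end Parametric

/-! ### Harmonicity of the Poisson kernel and of Poisson integrals. -/

section Euclidean

variable {d : ℕ}

local notation "X" => EuclideanSpace ℝ (Fin d)

/-- Expresses harmonicity linearly in the second Fréchet derivative, the object that passes under
the integral. -/
theorem laplacian_add_iteratedDeriv_eq {G : X × ℝ → ℂ} (hG : ContDiffOn ℝ 2 G {z | 0 < z.2})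
    {x : X} {t : ℝ} (ht : 0 < t) :
    Laplacian.laplacian (fun y => G (y, t)) x + iteratedDeriv 2 (fun s => G (x, s)) t =
      ∑ i, fderiv ℝ (fderiv ℝ G) (x, t) (EuclideanSpace.single i 1, 0)
          (EuclideanSpace.single i 1, 0) +
        fderiv ℝ (fderiv ℝ G) (x, t) (0, 1) (0, 1) := by
  obtain ⟨h1, h2, h3⟩ := contDiffOn_two_iff.1 hG
  have d1 : ∀ z : X × ℝ, 0 < z.2 → HasFDerivAt G (fderiv ℝ G z) z := fun z hz =>
    (h1.differentiableAt (isOpen_upperHalf.mem_nhds hz)).hasFDerivAt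
  have d2 : ∀ z : X × ℝ, 0 < z.2 → HasFDerivAt (fderiv ℝ G) (fderiv ℝ (fderiv ℝ G) z) z :=
    fun z hz => (h2.differentiableAt (isOpen_upperHalf.mem_nhds hz)).hasFDerivAt
  congr 1
  · rw [InnerProductSpace.laplacian_eq_iteratedFDeriv_orthonormalBasis _
      (EuclideanSpace.basisFun (Fin d) ℝ)]
    refine Finset.sum_congr rfl fun i _ => ?_
    rw [iteratedFDeriv_two_apply]
    have e1 : fderiv ℝ (fun y => G (y, t)) =
        fun y => (fderiv ℝ G (y, t)).comp (ContinuousLinearMap.inl ℝ X ℝ) := by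
      funext y
      exact ((d1 (y, t) ht).comp y (hasFDerivAt_prodMk_left y t)).fderiv
    have e2 : HasFDerivAt (fun y : X => fderiv ℝ G (y, t))
        ((fderiv ℝ (fderiv ℝ G) (x, t)).comp (ContinuousLinearMap.inl ℝ X ℝ)) x :=
      (d2 (x, t) ht).comp x (hasFDerivAt_prodMk_left x t)
    rw [e1, (e2.clm_comp (hasFDerivAt_const _ _)).fderiv]
    simp
  · have l1 : ∀ s : ℝ, HasDerivAt (fun s : ℝ => (x, s)) ((0 : X), (1 : ℝ)) s := fun s =>
      (hasDerivAt_const s x).prodMk (hasDerivAt_id s)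
    rw [iteratedDeriv_succ, iteratedDeriv_one]
    have e1 : deriv (fun s => G (x, s)) =ᶠ[𝓝 t] fun s => fderiv ℝ G (x, s) (0, 1) := by
      filter_upwards [lt_mem_nhds ht] with s hs
      exact ((d1 (x, s) hs).comp_hasDerivAt s (l1 s)).deriv
    have e2 : HasDerivAt (fun s => fderiv ℝ G (x, s)) (fderiv ℝ (fderiv ℝ G) (x, t) (0, 1)) t :=
      (d2 (x, t) ht).comp_hasDerivAt t (l1 t)
    rw [e1.deriv_eq]
    simpa using (e2.clm_apply (hasDerivAt_const t ((0 : X), (1 : ℝ)))).deriv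

/-- The Poisson kernel of the half space, up to the normalizing constant. -/
noncomputable def poissonKernel (d : ℕ) (z : EuclideanSpace ℝ (Fin d) × ℝ) : ℝ :=
  z.2 * (‖z.1‖ ^ 2 + z.2 ^ 2) ^ (-(d + 1 : ℝ) / 2)

theorem contDiffOn_poissonKernel :
    ContDiffOn ℝ 2 (fun z : X × ℝ => (poissonKernel d z : ℂ)) {z | 0 < z.2} := by
  refine Complex.ofRealCLM.contDiff.comp_contDiffOn (ContDiffOn.mul contDiff_snd.contDiffOn ?_)
  refine ContDiffOn.rpow_const_of_ne ?_ fun z hz => ?_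
  · exact ((contDiff_fst.norm_sq ℝ).add (contDiff_snd.pow 2)).contDiffOn
  · have : 0 < z.2 := hz
    positivity

/-- On the line through `(x, t)` in direction `(w, τ)` the kernel is `(t + s τ) Q(s)^a` with `Q`
quadratic; the right side is its second derivative at `s = 0`. -/
theorem fderiv_fderiv_poissonKernel {x w : X} {t τ : ℝ} (ht : 0 < t) :
    fderiv ℝ (fderiv ℝ fun z : X × ℝ => (poissonKernel d z : ℂ)) (x, t) (w, τ) (w, τ) =
      ((let a := -(d + 1 : ℝ) / 2
        let N := ‖x‖ ^ 2 + t ^ 2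
        let b := inner ℝ x w + t * τ
        2 * τ * (2 * b * a * N ^ (a - 1)) + t * (2 * (‖w‖ ^ 2 + τ ^ 2) * a * N ^ (a - 1) +
          2 * b * a * (2 * b * (a - 1) * N ^ (a - 2))) : ℝ) : ℂ) := by
  obtain ⟨h1, h2, -⟩ := contDiffOn_two_iff.1 (contDiffOn_poissonKernel (d := d))
  set a := -(d + 1 : ℝ) / 2
  set N := ‖x‖ ^ 2 + t ^ 2
  set b := inner ℝ x w + t * τ
  set c := ‖w‖ ^ 2 + τ ^ 2
  have hN : 0 < N := by positivity
  have hU := isOpen_upperHalf.mem_nhds (show (x, t) ∈ {z : X × ℝ | 0 < z.2} from ht)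
  set Q : ℝ → ℝ := fun s => N + 2 * b * s + c * s ^ 2
  have hQ : ∀ s, HasDerivAt Q (2 * b + 2 * c * s) s := by
    intro s
    have := (((hasDerivAt_id s).const_mul (2 * b)).const_add N).add
      (((hasDerivAt_id s).pow 2).const_mul c)
    exact HasDerivAt.congr_deriv (f := Q) this (by simp; ring)
  have hQ0 : Q 0 = N := by simp [Q]
  have hQpos : ∀ᶠ s in 𝓝 (0 : ℝ), 0 < Q s :=
    (hQ 0).continuousAt.eventually_const_lt (by rw [hQ0]; exact hN)
  have hl : ∀ s : ℝ, HasDerivAt (fun s => t + s * τ) τ s := fun s => by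
    simpa using ((hasDerivAt_id s).mul_const τ).const_add t
  have hline : ∀ s : ℝ, poissonKernel d ((x, t) + s • (w, τ)) = (t + s * τ) * Q s ^ a := by
    intro s
    have : ‖x + s • w‖ ^ 2 + (t + s * τ) ^ 2 = Q s := by
      rw [norm_add_sq_real, inner_smul_right, norm_smul, mul_pow, Real.norm_eq_abs, sq_abs]
      simp only [Q, N, b, c]; ring
    simp only [poissonKernel, Prod.fst_add, Prod.snd_add, Prod.smul_fst, Prod.smul_snd,
      smul_eq_mul, this, a]
  refine fderiv_fderiv_apply_eq_of_line
    (h₁ := fun s => ((τ * Q s ^ a + (t + s * τ) * ((2 * b + 2 * c * s) * a * Q s ^ (a - 1)) : ℝ) : ℂ))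
    (eventually_of_mem hU fun w hw => h1.differentiableAt (isOpen_upperHalf.mem_nhds hw))
    (h2.differentiableAt hU) ?_ ?_
  · filter_upwards [hQpos] with s hs
    simp_rw [hline]
    exact ((hl s).mul ((hQ s).rpow_const (Or.inl hs.ne'))).ofReal_comp
  · have hb : HasDerivAt (fun s : ℝ => 2 * b + 2 * c * s) (2 * c) 0 := by
      simpa using ((hasDerivAt_id (0 : ℝ)).const_mul (2 * c)).const_add (2 * b)
    have hne : Q 0 ≠ 0 := by rw [hQ0]; exact hN.ne'
    have := ((((hQ 0).rpow_const (p := a) (Or.inl hne)).const_mul τ).add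
      ((hl 0).mul ((hb.mul_const a).mul ((hQ 0).rpow_const (p := a - 1) (Or.inl hne))))).ofReal_comp
    refine this.congr_deriv ?_
    congr 1
    simp only [hQ0]
    rw [show a - 1 - 1 = a - 2 by ring]
    simp [hQ0]
    ring

/-- With `∑ x_i² = N - t²` and `N^(a-1) = N · N^(a-2)`, the sum collapses to a multiple of `d + 1 +
2a`, which the exponent `a` makes zero. -/
theorem poissonKernel_harmonic (x : X) {t : ℝ} (ht : 0 < t) :
    ∑ i, fderiv ℝ (fderiv ℝ fun z : X × ℝ => (poissonKernel d z : ℂ)) (x, t)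
        (EuclideanSpace.single i 1, 0) (EuclideanSpace.single i 1, 0) +
      fderiv ℝ (fderiv ℝ fun z : X × ℝ => (poissonKernel d z : ℂ)) (x, t) (0, 1) (0, 1) = 0 := by
  simp_rw [fderiv_fderiv_poissonKernel ht]
  rw [← Complex.ofReal_sum, ← Complex.ofReal_add, Complex.ofReal_eq_zero]
  set a := -(d + 1 : ℝ) / 2 with ha
  set N := ‖x‖ ^ 2 + t ^ 2 with hNdef
  have hN : 0 < N := by positivity
  have hsum : ∑ i, x i ^ 2 = N - t ^ 2 := by
    rw [hNdef, EuclideanSpace.real_norm_sq_eq]; ring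
  have h1 : N ^ (a - 1) = N * N ^ (a - 2) := by
    rw [show a - 1 = 1 + (a - 2) by ring, Real.rpow_add hN, Real.rpow_one]
  have h2 : ∀ i : Fin d, 2 * (0 : ℝ) * (2 * (inner ℝ x (EuclideanSpace.single i (1 : ℝ)) + t * 0) * a *
      N ^ (a - 1)) + t * (2 * (‖(EuclideanSpace.single i (1 : ℝ) : X)‖ ^ 2 + 0 ^ 2) * a * N ^ (a - 1) +
        2 * (inner ℝ x (EuclideanSpace.single i (1 : ℝ)) + t * 0) * a *
        (2 * (inner ℝ x (EuclideanSpace.single i (1 : ℝ)) + t * 0) * (a - 1) * N ^ (a - 2))) =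
      t * (2 * a * N ^ (a - 1)) + t * 4 * a * (a - 1) * N ^ (a - 2) * x i ^ 2 := by
    intro i
    simp [EuclideanSpace.inner_single_right]
    ring
  refine (congrArg (· + _) (Finset.sum_congr rfl fun i _ => h2 i)).trans ?_
  simp only [Finset.sum_add_distrib, ← Finset.mul_sum, hsum, Finset.sum_const,
    Finset.card_univ, Fintype.card_fin, nsmul_eq_mul, h1]
  simp
  rw [show (d : ℝ) = -2 * a - 1 by rw [ha]; ring]
  ring

theorem isHarmonic_convKernel {g : X → ℝ} {B R : ℝ} (hg : Measurable g) (hgB : ∀ y, |g y| ≤ B)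
    (hgR : ∀ y, y ∉ closedBall (0 : X) R → g y = 0) :
    IsHarmonicOnUpperHalf fun (x : X) t =>
      convKernel volume g (fun z => (poissonKernel d z : ℂ)) (x, t) := by
  obtain ⟨h1, h2⟩ := fderiv_convKernel (m := (volume : Measure X))
    (contDiffOn_poissonKernel (d := d)) hg hgB hgR
  refine ⟨h1, fun x t ht => ?_⟩
  rw [laplacian_add_iteratedDeriv_eq h1 ht, h2 (x, t) ht]
  set D := fderiv ℝ (fderiv ℝ fun z : X × ℝ => (poissonKernel d z : ℂ))
  have hD : ContinuousOn D {z | 0 < z.2} := (contDiffOn_two_iff.1 contDiffOn_poissonKernel).2.2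
  have hint := integrable_convKernel (F := X × ℝ →L[ℝ] X × ℝ →L[ℝ] ℂ) (m := (volume : Measure X)) hD hg hgB hgR
    (z := (x, t)) ht
  have happ : ∀ v : X × ℝ, convKernel volume g D (x, t) v v =
      ∫ y, g y • D (x - y, t) v v := by
    intro v
    rw [convKernel, ContinuousLinearMap.integral_apply hint,
      ContinuousLinearMap.integral_apply (hint.apply_continuousLinearMap v)]
    rfl
  have hiv : ∀ v : X × ℝ, Integrable fun y => g y • D (x - y, t) v v := fun v =>
    (hint.apply_continuousLinearMap v).apply_continuousLinearMap v
  simp_rw [happ]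
  rw [← integral_finsetSum _ fun i _ => hiv _, ← integral_add
    (integrable_finsetSum _ fun i _ => hiv _) (hiv _)]
  refine (integral_congr_ae (Eventually.of_forall fun y => ?_)).trans (integral_zero X ℂ)
  have := poissonKernel_harmonic (x - y) ht
  simp only [← Finset.smul_sum, ← smul_add]
  rw [this, smul_zero]

end Euclidean

end HalfSpace

/-! ### Poisson integrals of non-negative functions and the embedding estimate. -/

namespace HalfSpace

open Metric Module Set Filter Topology CarlesonMeasure HardyLittlewood

section Embedding

variable {d : ℕ}

local notation "X" => EuclideanSpace ℝ (Fin d)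

theorem poissonKernel_nonneg (x : X) {t : ℝ} (ht : 0 < t) : 0 ≤ poissonKernel d (x, t) :=
  mul_nonneg ht.le (by positivity)

theorem poissonKernel_eq_dilate (x : X) {t : ℝ} (ht : 0 < t) :
    poissonKernel d (x, t) = (t ^ d)⁻¹ * poissonKernel d (t⁻¹ • x, 1) := by
  have h1 : ‖t⁻¹ • x‖ ^ 2 + 1 ^ 2 = (t ^ 2)⁻¹ * (‖x‖ ^ 2 + t ^ 2) := by
    rw [norm_smul, norm_inv, Real.norm_of_nonneg ht.le]
    field_simp
  have h2 : ((t ^ 2)⁻¹) ^ (-(d + 1 : ℝ) / 2) = t ^ (d + 1) := by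
    rw [Real.inv_rpow (by positivity), ← Real.rpow_neg (by positivity), ← Real.rpow_natCast t 2,
      ← Real.rpow_mul ht.le, ← Real.rpow_natCast t (d + 1)]
    congr 1
    push_cast
    ring
  simp only [poissonKernel, h1]
  rw [Real.mul_rpow (by positivity) (by positivity), h2]
  field_simp
  ring

theorem poissonKernel_one_antitone (x y : X) (h : ‖x‖ ≤ ‖y‖) :
    poissonKernel d (y, 1) ≤ poissonKernel d (x, 1) := by
  simp only [poissonKernel, one_mul]
  refine Real.rpow_le_rpow_of_nonpos (by positivity) (by gcongr) ?_
  have : (0 : ℝ) ≤ d := by positivity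
  linarith

theorem integrable_poissonKernel_one :
    Integrable (fun x : X => poissonKernel d (x, 1)) volume := by
  have h := integrable_rpow_neg_one_add_norm_sq (E := X) (μ := volume) (r := d + 1) (by simp)
  refine h.congr (Eventually.of_forall fun x => ?_)
  simp [poissonKernel, add_comm]

theorem measurable_poissonKernel : Measurable (poissonKernel d) := by
  unfold poissonKernel
  fun_prop

/-- The normalization `t^(-d)` cancels the volume factor `t^d`, so the constant depends on `φ` and
`d` alone. -/
theorem exists_lintegral_dilate_mul_le [Nontrivial X] {φ : X → ℝ}
    (hφ : ∀ x y, ‖x‖ ≤ ‖y‖ → φ y ≤ φ x) (hφ0 : ∀ x, 0 ≤ φ x) (hφi : Integrable φ volume) :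
    ∃ C : ℝ≥0, ∀ g : X → ℝ≥0∞, Measurable g → ∀ (x y : X) (t : ℝ), 0 < t → dist y x ≤ t →
      ∫⁻ z, ENNReal.ofReal ((t ^ d)⁻¹ * φ (t⁻¹ • (y - z))) * g z ≤
        C * maximalFunction volume g x := by
  set A := ENNReal.ofReal (4 ^ finrank ℝ X) *
        ((∫⁻ w, ENNReal.ofReal (φ w)) + ENNReal.ofReal (φ 0) * volume (closedBall (0 : X) 1))
  have hA : A ≠ ∞ := by
    refine ENNReal.mul_ne_top ENNReal.ofReal_ne_top (ENNReal.add_ne_top.2 ⟨?_, ?_⟩)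
    · rw [← ofReal_integral_eq_lintegral_ofReal hφi (Eventually.of_forall hφ0)]
      exact ENNReal.ofReal_ne_top
    · exact ENNReal.mul_ne_top ENNReal.ofReal_ne_top (measure_closedBall_ne_top _ _ _)
  refine ⟨A.toNNReal, fun g hg x y t ht hxy => ?_⟩
  have hn : finrank ℝ X = d := finrank_euclideanSpace_fin
  have h1 := lintegral_radial_mul_le volume hφ hφ0 hg ht hxy
  have ht' : 0 ≤ (t ^ d)⁻¹ := by positivity
  simp_rw [ENNReal.ofReal_mul ht', mul_assoc]
  rw [lintegral_const_mul' _ _ ENNReal.ofReal_ne_top, ENNReal.coe_toNNReal hA]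
  calc _ ≤ ENNReal.ofReal (t ^ d)⁻¹ * (A * (ENNReal.ofReal (t ^ finrank ℝ X) *
        maximalFunction volume g x)) := by gcongr
    _ = (ENNReal.ofReal (t ^ d)⁻¹ * ENNReal.ofReal (t ^ d)) *
        (A * maximalFunction volume g x) := by rw [hn]; ring
    _ = _ := by
      rw [← ENNReal.ofReal_mul ht', inv_mul_cancel₀ (by positivity), ENNReal.ofReal_one, one_mul]

/-- The Poisson integral (up to normalization) of a non-negative function, with values in
`[0, ∞]`. -/
noncomputable def poissonLIntegral (h : X → ℝ≥0∞) (z : X × ℝ) : ℝ≥0∞ :=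
  ∫⁻ y, ENNReal.ofReal (poissonKernel d (z.1 - y, z.2)) * h y

theorem measurable_poissonLIntegral {h : X → ℝ≥0∞} (hh : Measurable h) :
    Measurable (poissonLIntegral h) := by
  have : Measurable fun w : (X × ℝ) × X =>
      ENNReal.ofReal (poissonKernel d (w.1.1 - w.2, w.1.2)) * h w.2 :=
    (measurable_poissonKernel.comp (by fun_prop : Measurable fun w : (X × ℝ) × X =>
      (w.1.1 - w.2, w.1.2))).ennreal_ofReal.mul (hh.comp measurable_snd)
  exact this.lintegral_prod_right' (ν := volume)

theorem exists_poissonLIntegral_le [Nontrivial X] :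
    ∃ C : ℝ≥0, ∀ g : X → ℝ≥0∞, Measurable g → ∀ (x : X) (t : ℝ), 0 < t →
      poissonLIntegral g (x, t) ≤ C * maximalFunction volume g x := by
  obtain ⟨C, hC⟩ := exists_lintegral_dilate_mul_le (φ := fun x : X => poissonKernel d (x, 1))
    poissonKernel_one_antitone (fun x => poissonKernel_nonneg x one_pos)
    integrable_poissonKernel_one
  refine ⟨C, fun g hg x t ht => ?_⟩
  simp only [poissonLIntegral, poissonKernel_eq_dilate _ ht]
  exact hC g hg x x t ht (by simpa using ht.le)

/-- On the ball the kernel is at least `t^(-d) 2^(-(d+1)/2)`, and the ball has volume `t^d ω`. Hence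
the Poisson integral controls any lower bound of `h` there. -/
theorem exists_le_poissonLIntegral :
    ∃ c : ℝ≥0, ∀ (h : X → ℝ≥0∞) (A : ℝ≥0∞) (x : X) (t : ℝ), 0 < t →
      (∀ y ∈ closedBall x t, A ≤ h y) → A ≤ c * poissonLIntegral h (x, t) := by
  obtain ⟨e, he⟩ : ∃ e : ℝ, e = 2 ^ (-(d + 1 : ℝ) / 2) := ⟨_, rfl⟩
  have he0 : 0 < e := by rw [he]; positivity
  set ω := volume (closedBall (0 : X) 1)
  have hω : ω ≠ 0 := measure_closedBall_ne_zero volume (0 : X) one_pos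
  have hω' : ω ≠ ∞ := measure_closedBall_ne_top volume (0 : X) 1
  have hB0 : ENNReal.ofReal e * ω ≠ 0 := mul_ne_zero (by simpa using he0) hω
  have hB : ENNReal.ofReal e * ω ≠ ∞ := ENNReal.mul_ne_top ENNReal.ofReal_ne_top hω'
  refine ⟨(ENNReal.ofReal e * ω)⁻¹.toNNReal, fun h A x t ht hA => ?_⟩
  rw [ENNReal.coe_toNNReal (ENNReal.inv_ne_top.2 hB0)]
  have hK : ∀ y ∈ closedBall x t, (t ^ d)⁻¹ * e ≤ poissonKernel d (x - y, t) := by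
    intro y hy
    rw [poissonKernel_eq_dilate _ ht]
    gcongr
    simp only [poissonKernel, one_mul, he]
    have h1 : ‖t⁻¹ • (x - y)‖ ≤ 1 := by
      rw [norm_smul, norm_inv, Real.norm_of_nonneg ht.le, inv_mul_le_iff₀ ht, mul_one,
        ← dist_eq_norm, dist_comm]
      exact hy
    refine Real.rpow_le_rpow_of_nonpos (by positivity) ?_ ?_
    · nlinarith [norm_nonneg (t⁻¹ • (x - y))]
    · have : (0 : ℝ) ≤ d := by positivity
      linarith
  have hmain : ENNReal.ofReal e * ω * A ≤ poissonLIntegral h (x, t) := by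
    calc ENNReal.ofReal e * ω * A
        = ENNReal.ofReal ((t ^ d)⁻¹ * e) * A * volume (closedBall x t) := by
          rw [measure_closedBall_eq volume x ht.le, finrank_euclideanSpace_fin,
            ENNReal.ofReal_mul (by positivity)]
          calc _ = (ENNReal.ofReal (t ^ d)⁻¹ * ENNReal.ofReal (t ^ d)) *
                (ENNReal.ofReal e * ω * A) := by
                rw [← ENNReal.ofReal_mul (by positivity), inv_mul_cancel₀ (by positivity),
                  ENNReal.ofReal_one, one_mul]
            _ = _ := by ring
      _ = ∫⁻ y in closedBall x t, ENNReal.ofReal ((t ^ d)⁻¹ * e) * A := by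
          rw [setLIntegral_const]
      _ ≤ ∫⁻ y in closedBall x t, ENNReal.ofReal (poissonKernel d (x - y, t)) * h y :=
          setLIntegral_mono' measurableSet_closedBall fun y hy =>
            mul_le_mul' (ENNReal.ofReal_le_ofReal (hK y hy)) (hA y hy)
      _ ≤ _ := setLIntegral_le_lintegral _ _
  calc A = (ENNReal.ofReal e * ω)⁻¹ * (ENNReal.ofReal e * ω * A) := by
        rw [← mul_assoc, ENNReal.inv_mul_cancel hB0 hB, one_mul]
    _ ≤ _ := by gcongr

/-- Truncation of a non-negative function in height and in space. -/
noncomputable def truncation (h : X → ℝ≥0∞) (n : ℕ) : X → ℝ≥0∞ :=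
  (closedBall 0 (n : ℝ)).indicator fun y => min (h y) n

theorem truncation_le (h : X → ℝ≥0∞) (n : ℕ) (y : X) : truncation h n y ≤ h y :=
  indicator_le' (fun _ _ => min_le_left _ _) (fun _ _ => zero_le) y

theorem truncation_le_natCast (h : X → ℝ≥0∞) (n : ℕ) (y : X) : truncation h n y ≤ n :=
  indicator_le' (fun _ _ => min_le_right _ _) (fun _ _ => zero_le) y

theorem measurable_truncation {h : X → ℝ≥0∞} (hh : Measurable h) (n : ℕ) :
    Measurable (truncation h n) :=
  (hh.min measurable_const).indicator measurableSet_closedBall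

theorem truncation_mono (h : X → ℝ≥0∞) : Monotone (truncation h) := by
  intro a b hab y
  have h1 : (a : ℝ) ≤ b := by exact_mod_cast hab
  have h2 : (a : ℝ≥0∞) ≤ b := by exact_mod_cast hab
  by_cases hy : y ∈ closedBall (0 : X) a
  · rw [truncation, truncation, indicator_of_mem hy,
      indicator_of_mem (closedBall_subset_closedBall h1 hy)]
    exact min_le_min_left _ h2
  · rw [truncation, indicator_of_notMem hy]
    exact zero_le

theorem iSup_truncation (h : X → ℝ≥0∞) (y : X) : ⨆ n, truncation h n y = h y := by
  refine le_antisymm (iSup_le fun n => truncation_le h n y) (le_of_forall_lt fun b hb => ?_)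
  obtain ⟨n₁, hn₁⟩ := ENNReal.exists_nat_gt hb.ne_top
  obtain ⟨n₂, hn₂⟩ := exists_nat_ge ‖y‖
  refine lt_iSup_iff.2 ⟨max n₁ n₂, ?_⟩
  have hy : y ∈ closedBall (0 : X) (max n₁ n₂ : ℕ) := by
    rw [mem_closedBall_zero_iff]
    exact hn₂.trans (by exact_mod_cast le_max_right _ _)
  rw [truncation, indicator_of_mem hy]
  exact lt_min hb (hn₁.trans_le (by exact_mod_cast le_max_left _ _))

theorem iSup_poissonLIntegral_truncation {h : X → ℝ≥0∞} (hh : Measurable h) (z : X × ℝ) :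
    ⨆ n, poissonLIntegral (truncation h n) z = poissonLIntegral h z := by
  unfold poissonLIntegral
  rw [← lintegral_iSup]
  · simp_rw [← ENNReal.mul_iSup, iSup_truncation]
  · intro n
    exact (measurable_poissonKernel.comp (by fun_prop)).ennreal_ofReal.mul
      (measurable_truncation hh n)
  · intro a b hab y
    dsimp only
    gcongr
    exact truncation_mono h hab y

/-- Links the harmonic function, to which the embedding applies, with the `[0, ∞]`-valued integral;
there is no cancellation because kernel and density are non-negative. -/
theorem enorm_convKernel_eq {h : X → ℝ≥0∞} (hh : Measurable h) {B R : ℝ}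
    (hB : ∀ y, h y ≤ ENNReal.ofReal B) (hR : ∀ y, y ∉ closedBall (0 : X) R → h y = 0)
    (x : X) {t : ℝ} (ht : 0 < t) :
    ‖convKernel volume (fun y => (h y).toReal) (fun z => (poissonKernel d z : ℂ)) (x, t)‖ₑ =
      poissonLIntegral h (x, t) := by
  have hB0 : ∀ y, |(h y).toReal| ≤ max B 0 := fun y => by
    rw [abs_of_nonneg ENNReal.toReal_nonneg]
    refine ENNReal.toReal_le_of_le_ofReal (le_max_right _ _) ((hB y).trans ?_)
    exact ENNReal.ofReal_le_ofReal (le_max_left _ _)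
  have hint := integrable_convKernel (m := (volume : Measure X))
    (contDiffOn_poissonKernel (d := d)).continuousOn hh.ennreal_toReal hB0
    (R := R) (fun y hy => by simp [hR y hy]) (z := (x, t)) ht
  have hre : Integrable (fun y => (h y).toReal * poissonKernel d (x - y, t)) volume := by
    have := hint.re
    simpa using this
  have h0 : ∀ y, 0 ≤ (h y).toReal * poissonKernel d (x - y, t) := fun y =>
    mul_nonneg ENNReal.toReal_nonneg (poissonKernel_nonneg _ ht)
  have h1 : convKernel volume (fun y => (h y).toReal) (fun z => (poissonKernel d z : ℂ)) (x, t) =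
      ((∫ y, (h y).toReal * poissonKernel d (x - y, t) : ℝ) : ℂ) := by
    rw [convKernel, ← integral_complex_ofReal]
    simp
  rw [h1, ← ofReal_norm, Complex.norm_real, Real.norm_of_nonneg (integral_nonneg h0),
    ofReal_integral_eq_lintegral_ofReal hre (Eventually.of_forall h0), poissonLIntegral]
  refine lintegral_congr fun y => ?_
  rw [ENNReal.ofReal_mul ENNReal.toReal_nonneg, ENNReal.ofReal_toReal
    ((hB y).trans_lt ENNReal.ofReal_lt_top).ne, mul_comm]

theorem eLpNorm_ofReal_eq {Y : Type*} [MeasurableSpace Y] {ν : Measure Y} (f : Y → ℂ) {p : ℝ}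
    (hp : 0 < p) :
    eLpNorm f (ENNReal.ofReal p) ν = (∫⁻ x, ‖f x‖ₑ ^ p ∂ν) ^ p⁻¹ := by
  rw [eLpNorm_eq_lintegral_rpow_enorm_toReal (by simpa using hp) ENNReal.ofReal_ne_top,
    ENNReal.toReal_ofReal hp.le, one_div]

/-- The embedding estimate, for Poisson integrals of arbitrary non-negative functions. -/
theorem exists_lintegral_poissonLIntegral_rpow_le [Nontrivial X] {α r : ℝ} (hα : 0 < α)
    (hr : 1 ≤ r) (hαr : 1 < α * r) {μ : Measure (UpperHalf d)} (hμ : EmbeddingEstimate α r μ) :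
    ∃ C : ℝ≥0, ∀ h : X → ℝ≥0∞, Measurable h →
      ∫⁻ z : UpperHalf d, poissonLIntegral h (z.1, z.2) ^ r ∂μ ≤
        C * (∫⁻ y, h y ^ (α * r)) ^ α⁻¹ := by
  have hr0 : 0 < r := by linarith
  have hp0 : 0 < α * r := by linarith
  obtain ⟨M, hM⟩ := hμ
  obtain ⟨C₁, hC₁⟩ := exists_poissonLIntegral_le (d := d)
  obtain ⟨C₂, hC₂⟩ := exists_lintegral_maximalFunction_rpow_le (volume : Measure X) hαr
  set p := α * r
  refine ⟨M ^ r * (C₁ ^ p * C₂) ^ α⁻¹, fun h hh => ?_⟩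
  -- The Poisson integral of `h` may be infinite, so the embedding is applied to truncations, with a
  -- constant independent of `n`.
  have hn : ∀ n : ℕ, ∫⁻ z : UpperHalf d, poissonLIntegral (truncation h n) (z.1, z.2) ^ r ∂μ ≤
      (M ^ r * (C₁ ^ p * C₂) ^ α⁻¹ : ℝ≥0) * (∫⁻ y, h y ^ p) ^ α⁻¹ := by
    intro n
    set hn := truncation h n with hndef
    have hmeas : Measurable hn := measurable_truncation hh n
    have hB : ∀ y, hn y ≤ ENNReal.ofReal n := fun y => by
      rw [ENNReal.ofReal_natCast]; exact truncation_le_natCast h n y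
    have hR : ∀ y, y ∉ closedBall (0 : X) n → hn y = 0 := fun y hy =>
      indicator_of_notMem hy _
    set u : X → ℝ → ℂ := fun x t =>
      convKernel volume (fun y => (hn y).toReal) (fun z => (poissonKernel d z : ℂ)) (x, t)
    have hu : ∀ x t, 0 < t → ‖u x t‖ₑ = poissonLIntegral hn (x, t) := fun x t ht =>
      enorm_convKernel_eq hmeas hB hR x ht
    have hharm : IsHarmonicOnUpperHalf u := by
      refine isHarmonic_convKernel hmeas.ennreal_toReal (B := n) (R := n) (fun y => ?_)
        (fun y hy => by simp [hR y hy])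
      rw [abs_of_nonneg ENNReal.toReal_nonneg]
      exact ENNReal.toReal_le_of_le_ofReal (by positivity) (hB y)
    -- Every slice is dominated by the same maximal function, so the bound is uniform in `t`.
    have hhardy : hardyNorm (ENNReal.ofReal p) u ≤ ((C₁ ^ p * C₂) * ∫⁻ y, hn y ^ p) ^ p⁻¹ := by
      refine iSup_le fun t => ?_
      have ht : 0 < (t : ℝ) := t.2
      rw [eLpNorm_ofReal_eq _ hp0]
      gcongr
      calc ∫⁻ x, ‖u x t‖ₑ ^ p ≤ ∫⁻ x, (C₁ : ℝ≥0∞) ^ p * maximalFunction volume hn x ^ p := by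
            refine lintegral_mono fun x => ?_
            dsimp only
            rw [hu x t ht, ← ENNReal.mul_rpow_of_nonneg _ _ hp0.le]
            gcongr
            exact hC₁ hn hmeas x t ht
        _ = (C₁ : ℝ≥0∞) ^ p * ∫⁻ x, maximalFunction volume hn x ^ p := by
            rw [lintegral_const_mul' _ _ (ENNReal.rpow_ne_top_of_nonneg hp0.le ENNReal.coe_ne_top)]
        _ ≤ (C₁ : ℝ≥0∞) ^ p * (C₂ * ∫⁻ y, hn y ^ p) := by gcongr; exact hC₂ hn hmeas
        _ = _ := by rw [mul_assoc]
    -- Used only for membership in the Hardy space; this bound, which depends on `n`, does not enter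
    -- the constant.
    have hfin : ∫⁻ y, hn y ^ p ≠ ∞ := by
      refine ne_top_of_le_ne_top (b := (n : ℝ≥0∞) ^ p * volume (closedBall (0 : X) n)) ?_ ?_
      · exact ENNReal.mul_ne_top (ENNReal.rpow_ne_top_of_nonneg hp0.le (by simp))
          (measure_closedBall_ne_top _ _ _)
      · rw [← lintegral_indicator_const measurableSet_closedBall]
        refine lintegral_mono fun y => ?_
        by_cases hy : y ∈ closedBall (0 : X) n
        · rw [indicator_of_mem hy]
          exact ENNReal.rpow_le_rpow (truncation_le_natCast h n y) hp0.le
        · rw [hR y hy, ENNReal.zero_rpow_of_pos hp0]; exact zero_le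
    have hmem : MemHardy (ENNReal.ofReal p) u := by
      refine ⟨hharm, hhardy.trans_lt ?_⟩
      refine (ENNReal.rpow_ne_top_of_nonneg (by positivity) (ENNReal.mul_ne_top ?_ hfin)).lt_top
      exact ENNReal.mul_ne_top (ENNReal.rpow_ne_top_of_nonneg hp0.le ENNReal.coe_ne_top)
        ENNReal.coe_ne_top
    have hemb := hM u hmem
    rw [eLpNorm_ofReal_eq _ hr0] at hemb
    have hint : ∫⁻ z : UpperHalf d, poissonLIntegral hn (z.1, z.2) ^ r ∂μ =
        ((∫⁻ z : UpperHalf d, ‖u z.1 z.2‖ₑ ^ r ∂μ) ^ r⁻¹) ^ r := by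
      rw [ENNReal.rpow_inv_rpow hr0.ne']
      exact lintegral_congr fun z => by rw [hu z.1 z.2 z.2.2]
    calc _ = _ := hint
      _ ≤ (M * ((C₁ ^ p * C₂) * ∫⁻ y, hn y ^ p) ^ p⁻¹) ^ r := by gcongr; exact hemb.trans (by gcongr)
      _ = M ^ r * ((C₁ ^ p * C₂) ^ α⁻¹ * (∫⁻ y, hn y ^ p) ^ α⁻¹) := by
        rw [ENNReal.mul_rpow_of_nonneg _ _ hr0.le, ← ENNReal.rpow_mul,
          show p⁻¹ * r = α⁻¹ by simp only [p]; field_simp,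
          ENNReal.mul_rpow_of_nonneg _ _ (by positivity)]
      _ ≤ M ^ r * ((C₁ ^ p * C₂) ^ α⁻¹ * (∫⁻ y, h y ^ p) ^ α⁻¹) := by
        gcongr with y
        exact truncation_le h n y
      _ = _ := by
        rw [ENNReal.coe_mul, ENNReal.coe_rpow_of_nonneg _ hr0.le,
          ENNReal.coe_rpow_of_nonneg _ (by positivity), ENNReal.coe_mul,
          ENNReal.coe_rpow_of_nonneg _ hp0.le, mul_assoc]
  -- Monotone convergence removes the truncation.
  have hsup : ∀ z : UpperHalf d, poissonLIntegral h (z.1, z.2) ^ r =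
      ⨆ n, poissonLIntegral (truncation h n) (z.1, z.2) ^ r := by
    intro z
    rw [← iSup_poissonLIntegral_truncation hh]
    exact (ENNReal.orderIsoRpow r hr0).map_iSup _
  simp_rw [hsup]
  rw [lintegral_iSup]
  · exact iSup_le hn
  · intro n
    exact ((measurable_poissonLIntegral (measurable_truncation hh n)).comp (by fun_prop)).pow_const _
  · intro a b hab z
    dsimp only [poissonLIntegral]
    gcongr
    exact truncation_mono h hab _

end Embedding

end HalfSpace

/-! ### Convolution with dilates: measurability, domination, existence. -/

namespace HalfSpace

open Metric Module Set Filter Topology CarlesonMeasure HardyLittlewood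

section Dilates

variable {d : ℕ}

local notation "X" => EuclideanSpace ℝ (Fin d)

theorem quasiMeasurePreserving_smul {c : ℝ} (hc : c ≠ 0) :
    Measure.QuasiMeasurePreserving (fun y : X => c • y) volume volume := by
  refine ⟨measurable_const_smul c, ?_⟩
  rw [Measure.map_addHaar_smul _ hc]
  exact Measure.smul_absolutelyContinuous

theorem dilate_ae_eq {Φ Ψ : X → ℂ} (h : Φ =ᵐ[volume] Ψ) {t : ℝ} (ht : 0 < t) :
    dilate Φ t =ᵐ[volume] dilate Ψ t := by
  filter_upwards [(quasiMeasurePreserving_smul (d := d) (inv_ne_zero ht.ne')).ae h] with y hy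
  simp only [dilate, hy]

/-- The equality holds at every point, not just almost everywhere, so passing to measurable
representatives is harmless even when `μ` is singular. -/
theorem dilateConv_congr {Φ Ψ f g : X → ℂ} (h : Φ =ᵐ[volume] Ψ) (h' : f =ᵐ[volume] g) :
    dilateConv Φ f = dilateConv Ψ g := by
  funext z
  refine integral_congr_ae ?_
  filter_upwards [dilate_ae_eq h z.2.2,
    (quasiMeasurePreserving_sub_left (volume : Measure X) z.1).ae h'] with y hy hy'
  rw [hy, hy']

theorem stronglyMeasurable_dilateConv {Φ f : X → ℂ} (hΦ : StronglyMeasurable Φ)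
    (hf : StronglyMeasurable f) : StronglyMeasurable (dilateConv Φ f) := by
  have h : StronglyMeasurable (Function.uncurry fun (z : UpperHalf d) (y : X) =>
      ContinuousLinearMap.mul ℝ ℂ (dilate Φ z.2 y) (f (z.1 - y))) := by
    refine Measurable.stronglyMeasurable ?_
    have h1 : Measurable fun w : UpperHalf d × X => f (w.1.1 - w.2) :=
      hf.measurable.comp (by fun_prop)
    have h2 : Measurable fun w : UpperHalf d × X => Φ ((w.1.2 : ℝ)⁻¹ • w.2) :=
      hΦ.measurable.comp (by fun_prop)
    have h3 : Measurable fun w : UpperHalf d × X => (((w.1.2 : ℝ) ^ d)⁻¹ : ℝ) := by fun_prop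
    exact (h3.smul h2).mul h1
  exact h.integral_prod_right

theorem aestronglyMeasurable_dilateConv {Φ f : X → ℂ} (hΦ : AEStronglyMeasurable Φ volume)
    (hf : AEStronglyMeasurable f volume) (μ : Measure (UpperHalf d)) :
    AEStronglyMeasurable (dilateConv Φ f) μ := by
  rw [dilateConv_congr hΦ.ae_eq_mk hf.ae_eq_mk]
  exact (stronglyMeasurable_dilateConv hΦ.stronglyMeasurable_mk
    hf.stronglyMeasurable_mk).aestronglyMeasurable

/-- Convolutions with the dilates of `Φ` are dominated nontangentially by the maximal function. -/
theorem exists_lintegral_enorm_dilate_mul_le [Nontrivial X] {Φ : X → ℂ}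
    (hΦ : HasRadialMajorant Φ) :
    ∃ C : ℝ≥0, ∀ f : X → ℂ, ∀ F : X → ℝ≥0∞, Measurable F → (∀ᵐ y, ‖f y‖ₑ = F y) →
      ∀ (x x' : X) (t : ℝ), 0 < t → x' ∈ closedBall x t →
        ∫⁻ y, ‖ContinuousLinearMap.mul ℝ ℂ (dilate Φ t y) (f (x - y))‖ₑ ≤
          C * maximalFunction volume F x' := by
  obtain ⟨φ, -, hφ, -, hφi, hle⟩ := hΦ
  -- The positive part is non-negative everywhere and keeps the monotonicity, the integrability and
  -- the majorization.
  obtain ⟨C, hC⟩ := exists_lintegral_dilate_mul_le (φ := fun x : X => max (φ x) 0)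
    (fun x y h => max_le_max_right 0 (hφ x y h)) (fun x => le_max_right _ _) hφi.pos_part
  refine ⟨C, fun f F hF hfF x x' t ht hx' => ?_⟩
  refine le_trans ?_ (hC F hF x' x t ht (by rw [dist_comm]; exact hx'))
  rw [← lintegral_sub_left_eq_self (fun z => ENNReal.ofReal ((t ^ d)⁻¹ *
    max (φ (t⁻¹ • (x - z))) 0) * F z) x]
  refine lintegral_mono_ae ?_
  filter_upwards [(quasiMeasurePreserving_smul (d := d) (inv_ne_zero ht.ne')).ae hle,
    (quasiMeasurePreserving_sub_left (volume : Measure X) x).ae hfF] with y hy hy'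
  rw [ContinuousLinearMap.mul_apply', enorm_mul, hy']
  simp only [sub_sub_cancel]
  gcongr
  rw [← ofReal_norm, dilate, norm_smul, Real.norm_of_nonneg (by positivity)]
  gcongr
  exact hy.trans (le_max_left _ _)

/-- The maximal function of `f` is finite almost everywhere, hence at some point of the ball `B(x,
t)`; nontangential domination by its value there gives absolute convergence at every `(x, t)`. -/
theorem convolutionExistsAt_dilate [Nontrivial X] {Φ f : X → ℂ}
    (hΦm : AEStronglyMeasurable Φ volume) (hΦ : HasRadialMajorant Φ) {p : ℝ} (hp : 1 < p)
    (hf : MemLp f (ENNReal.ofReal p) volume) (x : X) {t : ℝ} (ht : 0 < t) :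
    ConvolutionExistsAt (dilate Φ t) f x (ContinuousLinearMap.mul ℝ ℂ) volume := by
  have hp0 : 0 < p := by linarith
  obtain ⟨C, hC⟩ := exists_lintegral_enorm_dilate_mul_le hΦ
  obtain ⟨C₂, hC₂⟩ := exists_lintegral_maximalFunction_rpow_le (volume : Measure X) hp
  set F : X → ℝ≥0∞ := fun y => ‖hf.1.mk f y‖ₑ
  have hF : Measurable F := hf.1.stronglyMeasurable_mk.enorm
  have hfF : ∀ᵐ y, ‖f y‖ₑ = F y := hf.1.ae_eq_mk.mono fun y hy => by rw [hy]
  have hfin : ∫⁻ y, F y ^ p ≠ ∞ := by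
    have h1 := hf.2
    rw [eLpNorm_ofReal_eq _ hp0] at h1
    have h2 : ∫⁻ y, ‖f y‖ₑ ^ p = ∫⁻ y, F y ^ p :=
      lintegral_congr_ae (hfF.mono fun y hy => by simp only [hy])
    rw [h2] at h1
    intro h
    rw [h, ENNReal.top_rpow_of_pos (inv_pos.2 hp0)] at h1
    exact lt_irrefl _ h1
  have hM : ∀ᵐ y, maximalFunction volume F y ^ p < ∞ :=
    ae_lt_top ((measurable_maximalFunction volume hF).pow_const p)
      (ne_top_of_le_ne_top (ENNReal.mul_ne_top ENNReal.coe_ne_top hfin) (hC₂ F hF))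
  obtain ⟨x', hx', hMx⟩ : ∃ x' ∈ closedBall x t, maximalFunction volume F x' ^ p < ∞ := by
    by_contra! hcon
    refine measure_closedBall_ne_zero volume x ht (measure_mono_null (fun y hy => ?_) hM)
    exact not_lt.2 (hcon y hy)
  have hMx' : maximalFunction volume F x' ≠ ∞ := fun h => by
    simp [h, hp0] at hMx
  refine ⟨?_, lt_of_le_of_lt (hC f F hF hfF x x' t ht hx')
    (ENNReal.mul_lt_top ENNReal.coe_lt_top hMx'.lt_top)⟩
  have h1 : AEStronglyMeasurable (dilate Φ t) volume :=
    (hΦm.comp_quasiMeasurePreserving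
      (quasiMeasurePreserving_smul (d := d) (inv_ne_zero ht.ne'))).const_smul ((t ^ d)⁻¹ : ℝ)
  have h2 : AEStronglyMeasurable (fun y => f (x - y)) volume :=
    hf.1.comp_quasiMeasurePreserving (quasiMeasurePreserving_sub_left (volume : Measure X) x)
  exact h1.mul h2

end Dilates

end HalfSpace

/-! ### The main theorem. -/

open CarlesonMeasure HalfSpace HardyLittlewood in
theorem mainTheorem5 (d : ℕ) (hd : 1 ≤ d) (q α : ℝ) (hq : 1 < q) (hα : 1 / q < α)
    (Φ : EuclideanSpace ℝ (Fin d) → ℂ) (hΦ_meas : AEStronglyMeasurable Φ volume)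
    (hΦ : CarlesonMeasure.HasRadialMajorant Φ)
    (μ : Measure (CarlesonMeasure.UpperHalf d))
    (hμ : CarlesonMeasure.IsEmbeddingCarleson α μ) :
    ∃ c : ℝ≥0, ∀ f : EuclideanSpace ℝ (Fin d) → ℂ,
      MemLp f (ENNReal.ofReal (α * q)) volume →
        (∀ (x : EuclideanSpace ℝ (Fin d)) (t : ℝ), 0 < t →
          ConvolutionExistsAt (CarlesonMeasure.dilate Φ t) f x
            (ContinuousLinearMap.mul ℝ ℂ) volume) ∧
        AEStronglyMeasurable (CarlesonMeasure.dilateConv Φ f) μ ∧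
        eLpNorm (CarlesonMeasure.dilateConv Φ f) (ENNReal.ofReal q) μ
          ≤ c * eLpNorm f (ENNReal.ofReal (α * q)) volume := by
  have : Nontrivial (EuclideanSpace ℝ (Fin d)) :=
    Module.nontrivial_of_finrank_pos (R := ℝ) (by rw [finrank_euclideanSpace_fin]; omega)
  obtain ⟨hα0, r, hr, hαr, hemb⟩ := hμ
  have hq0 : 0 < q := by linarith
  have hr0 : 0 < r := by linarith
  have hp : 1 < α * q := by rwa [div_lt_iff₀ hq0] at hα
  have hp0 : 0 < α * q := by linarith
  obtain ⟨C, hC⟩ := exists_lintegral_enorm_dilate_mul_le hΦ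
  obtain ⟨C₂, hC₂⟩ := exists_lintegral_maximalFunction_rpow_le
    (volume : Measure (EuclideanSpace ℝ (Fin d))) hp
  obtain ⟨C₃, hC₃⟩ := exists_lintegral_poissonLIntegral_rpow_le hα0 hr hαr hemb
  obtain ⟨e, he⟩ := exists_le_poissonLIntegral (d := d)
  set p := α * q with hpdef
  refine ⟨(e ^ r * C₃ * (C ^ p * C₂) ^ α⁻¹) ^ q⁻¹, fun f hf =>
    ⟨fun x t ht => convolutionExistsAt_dilate hΦ_meas hΦ hp hf x ht,
      aestronglyMeasurable_dilateConv hΦ_meas hf.1 μ, ?_⟩⟩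
  set F : EuclideanSpace ℝ (Fin d) → ℝ≥0∞ := fun y => ‖hf.1.mk f y‖ₑ
  have hF : Measurable F := hf.1.stronglyMeasurable_mk.enorm
  have hfF : ∀ᵐ y, ‖f y‖ₑ = F y := hf.1.ae_eq_mk.mono fun y hy => by rw [hy]
  have hMm := measurable_maximalFunction volume hF
  -- The power `q / r` converts the exponent `r` of the embedding into `q`, and `α * r` into `α *
  -- q`.
  set h : EuclideanSpace ℝ (Fin d) → ℝ≥0∞ := fun y => (C * maximalFunction volume F y) ^ (q / r)
  have hh : Measurable h := (hMm.const_mul _).pow_const _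
  have hdom : ∀ z : UpperHalf d,
      ‖dilateConv Φ f z‖ₑ ^ q ≤ (e : ℝ≥0∞) ^ r * poissonLIntegral h (z.1, z.2) ^ r := by
    intro z
    -- The left side is a lower bound of `h` on the whole ball of radius `t` about `x`, by
    -- nontangential domination.
    have h1 : ‖dilateConv Φ f z‖ₑ ^ (q / r) ≤ e * poissonLIntegral h (z.1, z.2) := by
      refine he h _ z.1 z.2 z.2.2 fun y hy => ?_
      refine ENNReal.rpow_le_rpow ?_ (by positivity)
      exact (enorm_integral_le_lintegral_enorm _).trans (hC f F hF hfF z.1 y z.2 z.2.2 hy)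
    calc ‖dilateConv Φ f z‖ₑ ^ q = (‖dilateConv Φ f z‖ₑ ^ (q / r)) ^ r := by
          rw [← ENNReal.rpow_mul, div_mul_cancel₀ _ hr0.ne']
      _ ≤ (e * poissonLIntegral h (z.1, z.2)) ^ r := ENNReal.rpow_le_rpow h1 hr0.le
      _ = _ := ENNReal.mul_rpow_of_nonneg _ _ hr0.le
  have hhp : ∫⁻ y, h y ^ (α * r) ≤ ((C : ℝ≥0∞) ^ p * C₂) * ∫⁻ y, F y ^ p := by
    have h1 : ∀ y, h y ^ (α * r) = (C : ℝ≥0∞) ^ p * maximalFunction volume F y ^ p := by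
      intro y
      simp only [h]
      rw [← ENNReal.rpow_mul, show q / r * (α * r) = p by rw [hpdef]; field_simp,
        ENNReal.mul_rpow_of_nonneg _ _ hp0.le]
    simp_rw [h1]
    rw [lintegral_const_mul' _ _ (ENNReal.rpow_ne_top_of_nonneg hp0.le ENNReal.coe_ne_top),
      mul_assoc]
    gcongr
    exact hC₂ F hF
  have hfint : ∫⁻ y, ‖f y‖ₑ ^ p = ∫⁻ y, F y ^ p :=
    lintegral_congr_ae (hfF.mono fun y hy => by simp only [hy])
  rw [eLpNorm_ofReal_eq _ hq0, eLpNorm_ofReal_eq _ hp0, hfint]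
  calc (∫⁻ z, ‖dilateConv Φ f z‖ₑ ^ q ∂μ) ^ q⁻¹
      ≤ ((e : ℝ≥0∞) ^ r * (C₃ * (((C : ℝ≥0∞) ^ p * C₂) * ∫⁻ y, F y ^ p) ^ α⁻¹)) ^ q⁻¹ := by
        refine ENNReal.rpow_le_rpow ?_ (by positivity)
        refine (lintegral_mono hdom).trans ?_
        rw [lintegral_const_mul' _ _ (ENNReal.rpow_ne_top_of_nonneg hr0.le ENNReal.coe_ne_top)]
        gcongr
        exact (hC₃ h hh).trans (by gcongr)
    _ = _ := by
        have hα' : 0 ≤ α⁻¹ := by positivity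
        have hq' : 0 ≤ q⁻¹ := by positivity
        rw [ENNReal.mul_rpow_of_nonneg _ _ hα', ← mul_assoc, ← mul_assoc,
          ENNReal.mul_rpow_of_nonneg _ _ hq', ← ENNReal.rpow_mul, ← mul_inv, ← hpdef,
          ENNReal.coe_rpow_of_nonneg _ hq', ENNReal.coe_mul, ENNReal.coe_mul,
          ENNReal.coe_rpow_of_nonneg _ hr0.le, ENNReal.coe_rpow_of_nonneg _ hα', ENNReal.coe_mul,
          ENNReal.coe_rpow_of_nonneg _ hp0.le]
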